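/- Let $p,q,\gamma$ be real numbers with $p+q=1$, $0\le q<p$ and $0\le\gamma\le 1$, and let $n_1\ge 1$ be an integer. Blocks are found one after the other, independently, by a selfish miner with probability $q$ and by the honest miners with probability $p$. Honest miners work on the highest public chain; whenever two public branches of the same height compete, a fraction $\gamma$ of the honest hashrate works on the branch published by the selfish miner and the fraction $1-\gamma$ works on the other (honest) one. The selfish miner follows Strategy 1. He mines on his own fork and keeps his new blocks secret, except that, if his fork is entirely public and is in competition with an honest branch of the same height, a new block of his is published at once and wins the competition. Whenever the honest miners release a block, then: if their chain becomes higher than his fork, he adopts it; if his fork is exactly one block higher, he releases it completely and everybody adopts it; otherwise he makes public the part of his fork up to the height of the honest chain. An attack cycle starts when all miners agree on one chain and ends the next time they do so; the blocks of these common chains are the official blocks. An uncle is a non-official block whose parent is official. A block $N$ may refer to a previously found block $U$ which is known to the miner of $N$ (the selfish miner knows all blocks, the honest miners know theirs and those that he has published) if $U$ does not belong to the chain of $N$, the parent of $U$ does, and the distance (the height of $N$ minus the height of $U$) is between $1$ and $n_1$. Every block, honest or selfish, refers to all the blocks to which it may refer and which none of its ancestors has referred to (with no bound on their number); a nephew is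 an official block that refers to an uncle. For an attack cycle, let $U$ (resp. $U_s$, $U_h$) be the number of uncles created during the cycle which are referred, in the same cycle or in a later one, by a nephew (resp. by a nephew mined by the selfish miner, by a nephew mined by the honest miners). Then $U$, $U_s$ and $U_h$ are integrable, $\mathbb E[U_s]=\mathbb E[U]-\mathbb E[U_h]$, and \begin{align*} \mathbb E[U_s] ={}& q+\frac{q^3\gamma}{p-q}-\frac{pq^2}{p-q}\left(\frac qp\right)^{n_1-1}\gamma-q^{n_1+1}(1-\gamma)\\ &-\left[p^2q+\bigl(p+(1-\gamma)p^2q\bigr)\left(\frac{q^2}{p}\bigl(1-q^{n_1-1}\bigr)\gamma+(1-\gamma)\,pq^2\,\frac{1-(pq)^{n_1-1}}{1-pq}\right)\right]. \end{align*} -/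

import Mathlib

open MeasureTheory

namespace SelfishMining

/-- The three possible outcomes of the discovery of a block: it is found by the selfish miner, by an
honest miner who, when two public branches compete, works on the branch published by the selfish
miner, or by an honest miner who then works on the competing honest branch. -/
inductive Discovery
  | selfish
  | honestOnSelfish
  | honestOnHonest

instance : MeasurableSpace Discovery := ⊤

/-- The law of one discovery: relative hashrates `q` (selfish) and `p = 1 - q` (honest), and a
fraction `γ` of the honest hashrate works on the selfish branch when there is a competition. -/
noncomputable def discoveryLaw (q γ : ℝ) : Measure Discovery :=
  ENNReal.ofReal q • Measure.dirac Discovery.selfish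
    + ENNReal.ofReal ((1 - q) * γ) • Measure.dirac Discovery.honestOnSelfish
    + ENNReal.ofReal ((1 - q) * (1 - γ)) • Measure.dirac Discovery.honestOnHonest

/-- The law of the infinite sequence of independent discoveries. -/
noncomputable def miningLaw (q γ : ℝ) : Measure (ℕ → Discovery) :=
  Measure.infinitePi fun _ : ℕ => discoveryLaw q γ

/-- Blocks are numbered `0, 1, 2, …` in order of discovery. A chain of blocks is the list of its
blocks, the newest first, down to the common starting block, which is left out (so the chain that
consists of the starting block alone is `[]`, and the length of a chain is the height of its tip).

A state records the chain of the selfish miner, the part of it which is public, and the public chain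
on which honest miners work who do not follow the selfish miner. The last two always have the same
height; they differ exactly when there is a public competition between two branches. -/
structure State where
  secret : List ℕ
  published : List ℕ
  honest : List ℕ

/-- The chain on top of which the next block is mined. -/
def State.parentChain (s : State) : Discovery → List ℕ
  | .selfish => s.secret
  | .honestOnSelfish => s.published
  | .honestOnHonest => s.honest

/-- All miners agree on one chain, with nothing kept secret: an attack cycle has just ended and the
next one begins. -/
def State.Synced (s : State) : Prop := s.secret = s.honest

/-- The selfish miner found block `b`. He keeps it secret, except in a competition where
all his blocks are already public: then the new block settles the competition in his favour. -/
def State.afterSelfish (s : State) (b : ℕ) : State :=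
  if s.secret.length = s.honest.length ∧ s.secret ≠ s.honest then
    ⟨b :: s.secret, b :: s.secret, b :: s.secret⟩
  else
    ⟨b :: s.secret, s.published, s.honest⟩

/-- The honest miners released the chain `c`, one block higher than the former public chains.
* If `c` is higher than the chain of the selfish miner, everybody adopts `c`.
* If the selfish miner is just one block ahead, he releases his whole fork, which everybody adopts.
* Otherwise, he makes public the part of his fork up to the height of `c` (and a competition
  starts or goes on). -/
def State.afterHonest (s : State) (c : List ℕ) : State :=
  if s.secret.length < c.length then
    ⟨c, c, c⟩
  else if s.secret.length = c.length + 1 then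
    ⟨s.secret, s.secret, s.secret⟩
  else
    ⟨s.secret, s.secret.drop (s.secret.length - c.length), c⟩

/-- Effect of the discovery `x` of block `b`. -/
def State.next (s : State) (b : ℕ) : Discovery → State
  | .selfish => s.afterSelfish b
  | .honestOnSelfish => s.afterHonest (b :: s.parentChain .honestOnSelfish)
  | .honestOnHonest => s.afterHonest (b :: s.parentChain .honestOnHonest)

/-- `state ω t` is the state after the discovery of blocks `0, …, t - 1`. In particular
block `t` is mined from `state ω t`. -/
def state (ω : ℕ → Discovery) : ℕ → State
  | 0 => ⟨[], [], []⟩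
  | t + 1 => (state ω t).next t (ω t)

/-- The ancestors of block `b`, the newest (its parent) first, without the starting block. -/
def ancestors (ω : ℕ → Discovery) (b : ℕ) : List ℕ := (state ω b).parentChain (ω b)

/-- The parent of block `b`; `none` stands for the starting block. -/
def parent? (ω : ℕ → Discovery) (b : ℕ) : Option ℕ := (ancestors ω b).head?

/-- The height of block `b` above the starting block. -/
def height (ω : ℕ → Discovery) (b : ℕ) : ℕ := (ancestors ω b).length + 1

/-- Block `b` belongs to the official blockchain: to a chain on which all miners agreed. -/
def Official (ω : ℕ → Discovery) (b : ℕ) : Prop :=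
  ∃ t, (state ω t).Synced ∧ b ∈ (state ω t).honest

/-- An uncle is an orphan block whose parent belongs to the official blockchain. -/
def IsUncle (ω : ℕ → Discovery) (u : ℕ) : Prop :=
  ¬ Official ω u ∧ ∀ v ∈ parent? ω u, Official ω v

/-- The miner of block `n` knows block `u < n` when mining `n`: the selfish miner knows all blocks,
the honest miners know their own blocks and those which the selfish miner has published. -/
def Known (ω : ℕ → Discovery) (n u : ℕ) : Prop :=
  ω n = .selfish ∨ ω u ≠ .selfish ∨ ∃ t ≤ n, u ∈ (state ω t).published

/-- Block `n` may refer to the earlier block `u` as an uncle: `u` is known, does not belong to the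
chain of `n`, has its parent in this chain, and is at a distance between `1` and `n₁` of `n`. -/
def Eligible (n₁ : ℕ) (ω : ℕ → Discovery) (n u : ℕ) : Prop :=
  u < n ∧ Known ω n u ∧ u ∉ ancestors ω n ∧ (∀ v ∈ parent? ω u, v ∈ ancestors ω n) ∧
    height ω u < height ω n ∧ height ω n ≤ height ω u + n₁

/-- All miners refer to all the blocks they can: block `n` refers to `u` if it may do so and
if no ancestor of `n` has done it already. -/
def Refers (n₁ : ℕ) (ω : ℕ → Discovery) (n u : ℕ) : Prop :=
  Eligible n₁ ω n u ∧ ∀ m, m < n → m ∈ ancestors ω n → ¬ Refers n₁ ω m u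
termination_by n

/-- The blocks found during the attack cycle which starts at time `0`. -/
def cycleBlocks (ω : ℕ → Discovery) : Set ℕ :=
  {b | ∀ t, 1 ≤ t → t ≤ b → ¬ (state ω t).Synced}

/-- The number of uncles created during the attack cycle which are referred (in this cycle
or a later one) by a nephew, i.e. a referring official block. -/
noncomputable def uncles (n₁ : ℕ) (ω : ℕ → Discovery) : ℕ :=
  Set.ncard {u | u ∈ cycleBlocks ω ∧ IsUncle ω u ∧ ∃ n, Official ω n ∧ Refers n₁ ω n u}

/-- The same with nephews mined by the selfish miner. -/
noncomputable def unclesSelfish (n₁ : ℕ) (ω : ℕ → Discovery) : ℕ :=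
  Set.ncard {u | u ∈ cycleBlocks ω ∧ IsUncle ω u ∧
    ∃ n, Official ω n ∧ ω n = .selfish ∧ Refers n₁ ω n u}

/-- The same with nephews mined by the honest miners. -/
noncomputable def unclesHonest (n₁ : ℕ) (ω : ℕ → Discovery) : ℕ :=
  Set.ncard {u | u ∈ cycleBlocks ω ∧ IsUncle ω u ∧
    ∃ n, Official ω n ∧ ω n ≠ .selfish ∧ Refers n₁ ω n u}

end SelfishMining

/-! Write `p = 1 - q`. A cycle is decided by its first two blocks. If the first one is honest, there
is no uncle. If a selfish block is followed by an honest one, the third block ends the cycle: the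
loser of the two competing blocks is the only uncle, and the third block is its nephew. On average
this gives `pq` referred uncles, `p²q` of them with an honest nephew.

If the cycle starts with two selfish blocks, the whole selfish fork becomes official, and the lead
is a random walk started at two and stopped at one (`excursion`, `fork_cycle`). The uncles are the
honest blocks mined on the published branch, and the one mined on the honest branch while no earlier
honest block exists (`fork_isUncle_iff`). An uncle found at lead `i + 2` is at distance `i + 2` from
the first official block above the fork as it then stands. No official nephew can be closer, and
this block does refer to the uncle when `i + 2 ≤ n₁`, because all its ancestors are older than the
uncle. It is honest exactly when the next `i` discoveries are honest, so that the cycle ends with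
the fork unchanged, and the next official block is honest too, which has probability `p + (1 -
γ)p²q` (`fork_next_official`).

So almost surely the counts are numbers of occurring events, each decided by finitely many
discoveries, and expectations are sums of probabilities (`integral_ncard`). The lead `i + 2` is
visited `(1/p)(q/p)^i` times on average (`hasSum_walkProb`), so that the uncles found there
contribute `q²(γ(q/p)^i + p(1 - γ)q^i)` in the mean; for honest nephews this is multiplied by `p^i(p
+ (1 - γ)p²q)`. Geometric sums over `i < n₁ - 1` yield `E[U]` and `E[U_h]`. An uncle has at most one
official nephew (`nephew_unique`), so `E[U_s]` is the difference. -/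

namespace SelfishMining

/-! ### Chains, ancestors, official blocks and nephews -/

/-- Every block of the chain `c` has the blocks below it in `c` as its ancestors. -/
def Coherent (ω : ℕ → Discovery) (c : List ℕ) : Prop :=
  ∀ b r, (b :: r) <:+ c → ancestors ω b = r

lemma Coherent.nil (ω : ℕ → Discovery) : Coherent ω [] := by
  intro b r h
  simp at h

lemma Coherent.cons {ω : ℕ → Discovery} {c : List ℕ} (hc : Coherent ω c) {b : ℕ}
    (hb : ancestors ω b = c) : Coherent ω (b :: c) := by
  intro a r h
  rcases List.suffix_cons_iff.1 h with h | h
  · simp only [List.cons.injEq] at h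
    rw [h.1, h.2, hb]
  · exact hc a r h

lemma Coherent.suffix {ω : ℕ → Discovery} {c d : List ℕ} (hc : Coherent ω c) (h : d <:+ c) :
    Coherent ω d :=
  fun b r hbr => hc b r (hbr.trans h)

/-- The transition of the state preserves every property of chains which is inherited by
suffixes (of at least a given length) and extended by the new block. -/
lemma next_induction {P : List ℕ → Prop} {l : ℕ} {s : State} {b : ℕ} {x : Discovery}
    (hlen : s.published.length = s.honest.length) (hl : l ≤ s.honest.length)
    (hsuf : ∀ c d, P c → d <:+ c → l ≤ d.length → P d)
    (hcons : P (s.parentChain x) → P (b :: s.parentChain x))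
    (h₁ : P s.secret) (h₂ : P s.published) (h₃ : P s.honest) :
    P (s.next b x).secret ∧ P (s.next b x).published ∧ P (s.next b x).honest := by
  have key : ∀ c : List ℕ, P (b :: c) → s.honest.length = c.length →
      P (s.afterHonest (b :: c)).secret ∧ P (s.afterHonest (b :: c)).published ∧
        P (s.afterHonest (b :: c)).honest := by
    intro c hc hcl
    unfold State.afterHonest
    split_ifs with h h'
    · exact ⟨hc, hc, hc⟩
    · exact ⟨h₁, h₁, h₁⟩
    · refine ⟨h₁, hsuf _ _ h₁ (List.drop_suffix _ _) ?_, hc⟩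
      simp only [List.length_drop, List.length_cons] at *
      omega
  cases x with
  | selfish =>
    have := hcons h₁
    simp only [State.next, State.afterSelfish, State.parentChain] at *
    split_ifs
    · exact ⟨this, this, this⟩
    · exact ⟨this, h₂, h₃⟩
  | honestOnSelfish => exact key _ (hcons h₂) hlen.symm
  | honestOnHonest => exact key _ (hcons h₃) rfl

lemma state_succ (ω : ℕ → Discovery) (t : ℕ) :
    state ω (t + 1) = (state ω t).next t (ω t) := rfl

/-- The public branches have the same height, and the published blocks of the selfish miner form
the lower part of his fork. -/
lemma state_published (ω : ℕ → Discovery) (t : ℕ) :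
    (state ω t).published.length = (state ω t).honest.length ∧
      (state ω t).published <:+ (state ω t).secret := by
  induction t with
  | zero => simp [state]
  | succ t ih =>
    rw [state_succ]
    generalize state ω t = s at *
    have key : ∀ c : List ℕ,
        (s.afterHonest c).published.length = (s.afterHonest c).honest.length ∧
        (s.afterHonest c).published <:+ (s.afterHonest c).secret := by
      intro c
      unfold State.afterHonest
      split_ifs with h h'
      · simp
      · simp
      · refine ⟨?_, List.drop_suffix _ _⟩
        simp only [List.length_drop]
        omega
    cases ω t with
    | selfish =>
      simp only [State.next, State.afterSelfish]
      split_ifs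
      · simp
      · exact ⟨ih.1, ih.2.trans (List.suffix_cons _ _)⟩
    | honestOnSelfish => exact key _
    | honestOnHonest => exact key _

lemma state_coherent (ω : ℕ → Discovery) (t : ℕ) :
    Coherent ω (state ω t).secret ∧ Coherent ω (state ω t).published ∧
      Coherent ω (state ω t).honest := by
  induction t with
  | zero => simp [state, Coherent.nil]
  | succ t ih =>
    exact next_induction (state_published ω t).1 (Nat.zero_le _)
      (fun c d hc hd _ => hc.suffix hd) (fun h => h.cons rfl) ih.1 ih.2.1 ih.2.2

lemma state_lt (ω : ℕ → Discovery) (t : ℕ) :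
    (∀ b ∈ (state ω t).secret, b < t) ∧ (∀ b ∈ (state ω t).published, b < t) ∧
      (∀ b ∈ (state ω t).honest, b < t) := by
  induction t with
  | zero => simp [state]
  | succ t ih =>
    refine next_induction (P := fun c => ∀ b ∈ c, b < t + 1) (state_published ω t).1
      (Nat.zero_le _) (fun c d hc hd _ b hb => hc b (hd.subset hb)) (fun h => ?_)
      (fun b hb => (ih.1 b hb).trans t.lt_succ_self)
      (fun b hb => (ih.2.1 b hb).trans t.lt_succ_self)
      (fun b hb => (ih.2.2 b hb).trans t.lt_succ_self)
    simpa using h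

lemma ancestors_lt {ω : ℕ → Discovery} {n b : ℕ} (h : b ∈ ancestors ω n) : b < n := by
  obtain ⟨h₁, h₂, h₃⟩ := state_lt ω n
  unfold ancestors at h
  cases hx : ω n <;> rw [hx] at h
  · exact h₁ b h
  · exact h₂ b h
  · exact h₃ b h

/-- The published part is a suffix of the fork with the height of the honest chain, so it is the
whole fork once these two agree. -/
lemma state_of_synced {ω : ℕ → Discovery} {t : ℕ} (h : (state ω t).Synced) :
    state ω t = ⟨(state ω t).honest, (state ω t).honest, (state ω t).honest⟩ := by
  obtain ⟨h₁, h₂⟩ := state_published ω t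
  rw [State.Synced] at h
  rw [h] at h₂
  have h₃ := h₂.eq_of_length h₁
  cases hs : state ω t
  simp_all

/-- A chain is only ever cut by the `drop` in `afterHonest`, which leaves at least the honest
height; so `D` survives in every later chain, and a block left out of `D` never comes back. The fate
of all blocks found before `T` is thus settled at `T`. -/
lemma state_after {ω : ℕ → Discovery} {T t : ℕ} {D : List ℕ} (hT : state ω T = ⟨D, D, D⟩)
    (ht : T ≤ t) :
    (D <:+ (state ω t).secret ∧ ∀ b ∈ (state ω t).secret, b < T → b ∈ D) ∧
    (D <:+ (state ω t).published ∧ ∀ b ∈ (state ω t).published, b < T → b ∈ D) ∧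
    (D <:+ (state ω t).honest ∧ ∀ b ∈ (state ω t).honest, b < T → b ∈ D) := by
  induction t, ht using Nat.le_induction with
  | base => simp +contextual [hT]
  | succ t ht ih =>
    refine next_induction (P := fun c => D <:+ c ∧ ∀ b ∈ c, b < T → b ∈ D)
      (state_published ω t).1 ih.2.2.1.length_le (fun c d hc hd hl => ⟨?_, ?_⟩)
      (fun h => ⟨h.1.trans (List.suffix_cons _ _), ?_⟩) ih.1 ih.2.1 ih.2.2
    · exact List.suffix_of_suffix_length_le hc.1 hd hl
    · exact fun b hb => hc.2 b (hd.subset hb)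
    · intro b hb hbT
      rcases List.mem_cons.1 hb with rfl | hb
      · omega
      · exact h.2 b hb hbT

lemma honest_suffix_of_synced {ω : ℕ → Discovery} {T t : ℕ} (hT : (state ω T).Synced)
    (h : T ≤ t) : (state ω T).honest <:+ (state ω t).honest :=
  (state_after (state_of_synced hT) h).2.2.1

lemma official_iff_mem {ω : ℕ → Discovery} {T b : ℕ} {D : List ℕ} (hT : state ω T = ⟨D, D, D⟩)
    (hb : b < T) : Official ω b ↔ b ∈ D := by
  constructor
  · rintro ⟨t, ht, hbt⟩
    rcases le_total t T with h | h
    · have := honest_suffix_of_synced ht h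
      rw [hT] at this
      exact this.subset hbt
    · exact (state_after hT h).2.2.2 b hbt hb
  · exact fun h => ⟨T, by simp [hT, State.Synced], by simpa [hT] using h⟩

/-- Two official blocks belong to a common official chain. -/
lemma exists_common_chain {ω : ℕ → Discovery} {m n : ℕ} (hm : Official ω m)
    (hn : Official ω n) :
    ∃ t, (state ω t).Synced ∧ m ∈ (state ω t).honest ∧ n ∈ (state ω t).honest := by
  obtain ⟨t, ht, hmt⟩ := hm
  obtain ⟨t', ht', hnt⟩ := hn
  rcases le_total t t' with h | h
  · exact ⟨t', ht', (honest_suffix_of_synced ht h).subset hmt, hnt⟩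
  · exact ⟨t, ht, hmt, (honest_suffix_of_synced ht' h).subset hnt⟩

lemma Coherent.exists_suffix {ω : ℕ → Discovery} {c : List ℕ} (hc : Coherent ω c) {b : ℕ}
    (hb : b ∈ c) : (b :: ancestors ω b) <:+ c := by
  obtain ⟨l, r, rfl⟩ := List.append_of_mem hb
  have : (b :: r) <:+ (l ++ b :: r) := List.suffix_append _ _
  rwa [hc b r this]

lemma Coherent.trichotomy {ω : ℕ → Discovery} {c : List ℕ} (hc : Coherent ω c) {m n : ℕ}
    (hm : m ∈ c) (hn : n ∈ c) : m = n ∨ m ∈ ancestors ω n ∨ n ∈ ancestors ω m := by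
  rcases List.suffix_or_suffix_of_suffix (hc.exists_suffix hm) (hc.exists_suffix hn) with h | h
  · rcases List.suffix_cons_iff.1 h with h | h
    · simp only [List.cons.injEq] at h
      exact Or.inl h.1
    · exact Or.inr (Or.inl (h.subset List.mem_cons_self))
  · rcases List.suffix_cons_iff.1 h with h | h
    · simp only [List.cons.injEq] at h
      exact Or.inl h.1.symm
    · exact Or.inr (Or.inr (h.subset List.mem_cons_self))

lemma Refers.eligible {n₁ : ℕ} {ω : ℕ → Discovery} {n u : ℕ} (h : Refers n₁ ω n u) :
    Eligible n₁ ω n u := by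
  rw [Refers] at h
  exact h.1

lemma Refers.not_ancestor {n₁ : ℕ} {ω : ℕ → Discovery} {m n u : ℕ} (h : Refers n₁ ω n u)
    (hm : m ∈ ancestors ω n) : ¬ Refers n₁ ω m u := by
  rw [Refers] at h
  exact h.2 m (ancestors_lt hm) hm

/-- At most one official block refers to a given block. -/
lemma nephew_unique {n₁ : ℕ} {ω : ℕ → Discovery} {m n u : ℕ} (hm : Official ω m)
    (hn : Official ω n) (hmu : Refers n₁ ω m u) (hnu : Refers n₁ ω n u) : m = n := by
  obtain ⟨t, -, hmt, hnt⟩ := exists_common_chain hm hn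
  rcases (state_coherent ω t).2.2.trichotomy hmt hnt with h | h | h
  · exact h
  · exact absurd hmu (hnu.not_ancestor h)
  · exact absurd hnu (hmu.not_ancestor h)

/-- A block refers to an eligible block which is newer than all its ancestors. -/
lemma Eligible.refers {n₁ : ℕ} {ω : ℕ → Discovery} {n u : ℕ} (h : Eligible n₁ ω n u)
    (hanc : ∀ m ∈ ancestors ω n, m ≤ u) : Refers n₁ ω n u := by
  rw [Refers]
  refine ⟨h, fun m _ hm hmu => ?_⟩
  have := hmu.eligible.1
  have := hanc m hm
  omega

/-- An official block which is newer than all blocks of a lower part `S` of the official chain is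
above `S`. -/
lemma length_lt_height {ω : ℕ → Discovery} {T n : ℕ} {S : List ℕ} (hT : (state ω T).Synced)
    (hS : S <:+ (state ω T).honest) (hn : Official ω n) (hSn : ∀ m ∈ S, m < n) :
    S.length < height ω n := by
  obtain ⟨t, hSt, hnt⟩ : ∃ t, S <:+ (state ω t).honest ∧ n ∈ (state ω t).honest := by
    obtain ⟨t, ht, hnt⟩ := hn
    rcases le_total t T with h | h
    · exact ⟨T, hS, (honest_suffix_of_synced ht h).subset hnt⟩
    · exact ⟨t, hS.trans (honest_suffix_of_synced hT h), hnt⟩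
  -- Both `S` and the chain ending in `n` lie in one chain, so one contains the other. If `n`
  -- belonged to `S`, it would be newer than itself.
  rcases List.suffix_or_suffix_of_suffix hSt ((state_coherent ω t).2.2.exists_suffix hnt)
    with h | h
  · rcases List.suffix_cons_iff.1 h with h | h
    · have := hSn n (h ▸ List.mem_cons_self)
      omega
    · exact Nat.lt_succ_of_le h.length_le
  · have := hSn n (h.subset List.mem_cons_self)
    omega

/-! ### The lead of the selfish miner as a stopped walk -/

/-- One step of the lead of the selfish miner as long as it is at least two; the lead one is
left for the cemetery `0`. -/
def walkStep : ℕ → Discovery → ℕ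
  | k + 2, .selfish => k + 3
  | k + 2, .honestOnSelfish => k + 1
  | k + 2, .honestOnHonest => k + 1
  | 0, _ => 0
  | 1, _ => 0

/-- The lead of the selfish miner, when it is two before the discovery of block `m`, until it
drops to one. -/
def walk (ω : ℕ → Discovery) (m : ℕ) : ℕ → ℕ
  | 0 => 2
  | t + 1 => walkStep (walk ω m t) (ω (m + t))

lemma walk_selfish {ω : ℕ → Discovery} {m t : ℕ} (h : 2 ≤ walk ω m t)
    (hω : ω (m + t) = .selfish) : walk ω m (t + 1) = walk ω m t + 1 := by
  obtain ⟨k, hk⟩ := Nat.exists_eq_add_of_le' h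
  rw [walk, hω, hk, walkStep]

lemma walk_honest {ω : ℕ → Discovery} {m t : ℕ} (h : 2 ≤ walk ω m t)
    (hω : ω (m + t) ≠ .selfish) : walk ω m (t + 1) + 1 = walk ω m t := by
  obtain ⟨k, hk⟩ := Nat.exists_eq_add_of_le' h
  rw [walk, hk]
  cases h : ω (m + t)
  · exact absurd h hω
  · rw [walkStep]
  · rw [walkStep]

/-- Both `0` and `1` are sent to `0`, so only a lead of at least two has a nonzero successor: a walk
that is still alive has never been below two. -/
lemma two_le_walk_of_succ {ω : ℕ → Discovery} {m t : ℕ} (h : walk ω m (t + 1) ≠ 0) :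
    2 ≤ walk ω m t := by
  by_contra h2
  have : walk ω m t = 0 ∨ walk ω m t = 1 := by omega
  rw [walk] at h
  rcases this with h3 | h3 <;> rw [h3, walkStep] at h <;> simp at h

lemma two_le_walk_of_le {ω : ℕ → Discovery} {m s t : ℕ} (hst : s ≤ t) (h : 2 ≤ walk ω m t) :
    2 ≤ walk ω m s := by
  induction t, hst using Nat.le_induction with
  | base => exact h
  | succ t _ ih => exact ih (two_le_walk_of_succ (by omega))

/-- A walk which drops below two is at one just after its last time above. -/
lemma exists_walk_end {ω : ℕ → Discovery} {m : ℕ} (h : ∃ t, walk ω m t < 2) :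
    ∃ t, walk ω m t = 2 ∧ ω (m + t) ≠ .selfish := by
  classical
  have hspec := Nat.find_spec h
  have hmin := fun t => Nat.find_min h (m := t)
  generalize Nat.find h = n at *
  cases n with
  | zero => simp [walk] at hspec
  | succ n =>
    have h2 : 2 ≤ walk ω m n := by
      have := hmin n n.lt_succ_self
      omega
    by_cases hω : ω (m + n) = .selfish
    · rw [walk_selfish h2 hω] at hspec
      omega
    · have := walk_honest h2 hω
      exact ⟨n, by omega, hω⟩

lemma State.next_honest {s : State} {b : ℕ} {x : Discovery} (hx : x ≠ .selfish) :
    s.next b x = s.afterHonest (b :: s.parentChain x) := by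
  cases x
  · exact absurd rfl hx
  · rfl
  · rfl

lemma length_parentChain {ω : ℕ → Discovery} {t : ℕ} {x : Discovery} (hx : x ≠ .selfish) :
    ((state ω t).parentChain x).length = (state ω t).honest.length := by
  cases x
  · exact absurd rfl hx
  · exact (state_published ω t).1
  · rfl

/-! ### Evolution of a cycle opened by two selfish blocks -/

section Excursion

variable {ω : ℕ → Discovery} {T : ℕ} {D : List ℕ}

lemma state_two_selfish (hT : state ω T = ⟨D, D, D⟩) (h₀ : ω T = .selfish)
    (h₁ : ω (T + 1) = .selfish) : state ω (T + 2) = ⟨(T + 1) :: T :: D, D, D⟩ := by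
  simp [state_succ, hT, h₀, h₁, State.next, State.afterSelfish]

/-- The state of a cycle which starts with two blocks of the selfish miner, as long as his lead
is at least two. -/
lemma excursion (hT : state ω T = ⟨D, D, D⟩) (h₀ : ω T = .selfish) (h₁ : ω (T + 1) = .selfish)
    {t : ℕ} (ht : 2 ≤ walk ω (T + 2) t) :
    (state ω (T + 2 + t)).secret.length =
        (state ω (T + 2 + t)).honest.length + walk ω (T + 2) t ∧
      (state ω (T + 2 + t)).secret.length + (state ω (T + 2 + t)).honest.length =
        2 * D.length + t + 2 ∧
      (∀ b, b ∈ (state ω (T + 2 + t)).secret ↔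
        b ∈ D ∨ T ≤ b ∧ b < T + 2 + t ∧ ω b = .selfish) ∧
      ((state ω (T + 2 + t)).honest = D ∨
        ∃ b r, (state ω (T + 2 + t)).honest = b :: r ∧ ω b ≠ .selfish) := by
  induction t with
  | zero =>
    simp only [Nat.add_zero, state_two_selfish hT h₀ h₁, walk]
    refine ⟨by simp, by simp; omega, fun b => ?_, by simp⟩
    simp only [List.mem_cons]
    constructor
    · rintro (rfl | rfl | h)
      · exact Or.inr ⟨by omega, by omega, h₁⟩
      · exact Or.inr ⟨by omega, by omega, h₀⟩
      · exact Or.inl h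
    · rintro (h | ⟨h2, h3, -⟩)
      · exact Or.inr (Or.inr h)
      · omega
  | succ t ih =>
    have hw := two_le_walk_of_succ (t := t) (by omega : walk ω (T + 2) (t + 1) ≠ 0)
    obtain ⟨i1, i2, i3, i4⟩ := ih hw
    have hpub := (state_published ω (T + 2 + t)).1
    have hpl := length_parentChain (ω := ω) (t := T + 2 + t) (x := ω (T + 2 + t))
    rw [← Nat.add_assoc (T + 2) t 1, state_succ]
    generalize hs : state ω (T + 2 + t) = s at *
    by_cases hω : ω (T + 2 + t) = .selfish
    · have : s.next (T + 2 + t) (ω (T + 2 + t)) =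
          ⟨(T + 2 + t) :: s.secret, s.published, s.honest⟩ := by
        rw [hω, State.next, State.afterSelfish, if_neg]
        rintro ⟨h, -⟩
        omega
      rw [this, walk_selfish hw hω]
      refine ⟨by simp; omega, by simp; omega, fun b => ?_, i4⟩
      simp only [List.mem_cons, i3]
      constructor
      · rintro (rfl | h | ⟨h2, h3, h4⟩)
        · exact Or.inr ⟨by omega, by omega, hω⟩
        · exact Or.inl h
        · exact Or.inr ⟨h2, by omega, h4⟩
      · rintro (h | ⟨h2, h3, h4⟩)
        · exact Or.inr (Or.inl h)
        · by_cases h5 : b = T + 2 + t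
          · exact Or.inl h5
          · exact Or.inr (Or.inr ⟨h2, by omega, h4⟩)
    · have hstep := walk_honest hw hω
      have hlen := hpl hω
      have : s.next (T + 2 + t) (ω (T + 2 + t)) =
          ⟨s.secret, s.secret.drop (s.secret.length - (s.honest.length + 1)),
            (T + 2 + t) :: s.parentChain (ω (T + 2 + t))⟩ := by
        rw [State.next_honest hω, State.afterHonest, if_neg, if_neg]
        · simp [hlen]
        · simp [hlen]; omega
        · simp [hlen]; omega
      rw [this]
      refine ⟨by simp [hlen]; omega, by simp [hlen]; omega, fun b => ?_,
        Or.inr ⟨_, _, rfl, hω⟩⟩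
      simp only [i3]
      constructor
      · rintro (h | ⟨h2, h3, h4⟩)
        · exact Or.inl h
        · exact Or.inr ⟨h2, by omega, h4⟩
      · rintro (h | ⟨h2, h3, h4⟩)
        · exact Or.inl h
        · refine Or.inr ⟨h2, ?_, h4⟩
          by_contra h5
          exact hω (by rwa [show T + 2 + t = b by omega])

/-- With a lead of at least two the honest chain cannot overtake, and both remaining cases of
`afterHonest`, full or partial release, keep the fork. -/
lemma excursion_secret_succ (hT : state ω T = ⟨D, D, D⟩) (h₀ : ω T = .selfish)
    (h₁ : ω (T + 1) = .selfish) {t : ℕ} (ht : 2 ≤ walk ω (T + 2) t)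
    (hω : ω (T + 2 + t) ≠ .selfish) :
    (state ω (T + 2 + t + 1)).secret = (state ω (T + 2 + t)).secret := by
  have i1 := (excursion hT h₀ h₁ ht).1
  have hlen := length_parentChain (ω := ω) (t := T + 2 + t) hω
  rw [state_succ, State.next_honest hω, State.afterHonest, if_neg]
  · split_ifs <;> rfl
  · simp [hlen]; omega

lemma excursion_end (hT : state ω T = ⟨D, D, D⟩) (h₀ : ω T = .selfish)
    (h₁ : ω (T + 1) = .selfish) {t : ℕ} (ht : walk ω (T + 2) t = 2)
    (hω : ω (T + 2 + t) ≠ .selfish) :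
    state ω (T + 2 + t + 1) = ⟨(state ω (T + 2 + t)).secret, (state ω (T + 2 + t)).secret,
      (state ω (T + 2 + t)).secret⟩ := by
  have i1 := (excursion hT h₀ h₁ ht.ge).1
  have hlen := length_parentChain (ω := ω) (t := T + 2 + t) hω
  rw [state_succ, State.next_honest hω, State.afterHonest, if_neg, if_pos]
  · simp [hlen]; omega
  · simp [hlen]; omega

/-- In a run of honest blocks the fork of the selfish miner does not change, and his lead
decreases by one with each block. -/
lemma excursion_run (hT : state ω T = ⟨D, D, D⟩) (h₀ : ω T = .selfish)
    (h₁ : ω (T + 1) = .selfish) {t i : ℕ} (ht : walk ω (T + 2) t = i + 2) {j : ℕ}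
    (hj : j ≤ i + 1) (hω : ∀ l < j, ω (T + 2 + t + l) ≠ .selfish) :
    walk ω (T + 2) (t + j) + j = i + 2 ∧
      (state ω (T + 2 + t + j)).secret = (state ω (T + 2 + t)).secret := by
  induction j with
  | zero => exact ⟨ht, rfl⟩
  | succ j ih =>
    obtain ⟨e1, e2⟩ := ih (by omega) (fun l hl => hω l (by omega))
    have h := hω j (by omega)
    rw [Nat.add_assoc (T + 2)] at h
    have hw := walk_honest (by omega) h
    have hs := excursion_secret_succ hT h₀ h₁ (t := t + j) (by omega) h
    rw [← Nat.add_assoc (T + 2) t j] at hs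
    rw [← Nat.add_assoc t, ← e2]
    exact ⟨by omega, hs⟩

end Excursion

/-! ### The first official block above a common chain -/

/-- The first official block found after time `T`, when all miners agree, is found by an honest
miner. -/
def HonestFirst (ω : ℕ → Discovery) (T : ℕ) : Prop :=
  ω T ≠ .selfish ∨ ω T = .selfish ∧ ω (T + 1) ≠ .selfish ∧ ω (T + 2) = .honestOnHonest

lemma state_one_honest {ω : ℕ → Discovery} {T : ℕ} {D : List ℕ} (hT : state ω T = ⟨D, D, D⟩)
    (h₀ : ω T ≠ .selfish) : state ω (T + 1) = ⟨T :: D, T :: D, T :: D⟩ := by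
  have hlen := length_parentChain (ω := ω) (t := T) h₀
  have hp : (state ω T).parentChain (ω T) = D := by
    rw [hT]
    cases ω T <;> rfl
  rw [hp, hT] at hlen
  rw [state_succ, State.next_honest h₀, hp, hT, State.afterHonest, if_pos (by simp)]

lemma state_competition {ω : ℕ → Discovery} {T : ℕ} {D : List ℕ}
    (hT : state ω T = ⟨D, D, D⟩) (h₀ : ω T = .selfish) (h₁ : ω (T + 1) ≠ .selfish) :
    state ω (T + 2) = ⟨T :: D, T :: D, (T + 1) :: D⟩ := by
  have e : state ω (T + 1) = ⟨T :: D, D, D⟩ := by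
    simp [state_succ, hT, h₀, State.next, State.afterSelfish]
  have hp : (state ω (T + 1)).parentChain (ω (T + 1)) = D := by
    rw [e]
    cases h : ω (T + 1)
    · exact absurd h h₁
    · rfl
    · rfl
  rw [state_succ, State.next_honest h₁, hp, e]
  simp [State.afterHonest]

lemma state_competition_end {ω : ℕ → Discovery} {T : ℕ} {D : List ℕ}
    (hT : state ω T = ⟨D, D, D⟩) (h₀ : ω T = .selfish) (h₁ : ω (T + 1) ≠ .selfish) :
    state ω (T + 3) = ⟨(T + 2) :: (state ω (T + 2)).parentChain (ω (T + 2)),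
      (T + 2) :: (state ω (T + 2)).parentChain (ω (T + 2)),
      (T + 2) :: (state ω (T + 2)).parentChain (ω (T + 2))⟩ := by
  have e := state_competition hT h₀ h₁
  rw [state_succ]
  cases h : ω (T + 2)
  · simp [e, State.next, State.afterSelfish, State.parentChain]
  · simp [e, State.next, State.afterHonest, State.parentChain]
  · simp [e, State.next, State.afterHonest, State.parentChain]

/-- After a time `T` when all miners agree on `D`, some block on top of `D` becomes official. -/
lemma exists_next_official {ω : ℕ → Discovery} {T : ℕ} {D : List ℕ}
    (hω : ∀ m, ∃ t, walk ω m t < 2) (hT : state ω T = ⟨D, D, D⟩) :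
    ∃ n, T ≤ n ∧ Official ω n ∧ ancestors ω n = D ∧ (ω n ≠ .selfish ↔ HonestFirst ω T) := by
  by_cases h₀ : ω T = .selfish
  · have hanc : ancestors ω T = D := by
      rw [ancestors, hT, h₀]
      rfl
    by_cases h₁ : ω (T + 1) = .selfish
    · obtain ⟨t, ht, hωt⟩ := exists_walk_end (hω (T + 2))
      refine ⟨T, le_rfl, ⟨T + 2 + t + 1, ?_, ?_⟩, hanc, by simp [HonestFirst, h₀, h₁]⟩
      · rw [excursion_end hT h₀ h₁ ht hωt]
        rfl
      · rw [excursion_end hT h₀ h₁ ht hωt]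
        exact ((excursion hT h₀ h₁ ht.ge).2.2.1 T).2 (Or.inr ⟨le_rfl, by omega, h₀⟩)
    · have hend := state_competition_end hT h₀ h₁
      have hcomp := state_competition hT h₀ h₁
      -- Only an honest block mined on the honest branch makes `T + 1` win the competition; the
      -- other two outcomes extend block `T`.
      by_cases h₂ : ω (T + 2) = .honestOnHonest
      · rw [hcomp, h₂, State.parentChain] at hend
        refine ⟨T + 1, by omega, ⟨T + 3, ?_, ?_⟩, ?_, by simp [HonestFirst, h₀, h₁, h₂]⟩
        · rw [hend]
          rfl
        · simp [hend]
        · have := (state_coherent ω (T + 3)).2.2 (T + 1) D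
          rw [hend] at this
          exact this (List.suffix_cons _ _)
      · have hpc : (state ω (T + 2)).parentChain (ω (T + 2)) = T :: D := by
          rw [hcomp]
          cases h : ω (T + 2)
          · rfl
          · rfl
          · exact absurd h h₂
        rw [hpc] at hend
        refine ⟨T, le_rfl, ⟨T + 3, ?_, ?_⟩, hanc, by simp [HonestFirst, h₀, h₂]⟩
        · rw [hend]
          rfl
        · simp [hend]
  · refine ⟨T, le_rfl, ⟨T + 1, ?_, ?_⟩, ?_, by simp [HonestFirst, h₀]⟩
    · rw [state_one_honest hT h₀]
      rfl
    · simp [state_one_honest hT h₀]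
    · rw [ancestors, hT]
      cases ω T <;> rfl

lemma excursion_secret_suffix {ω : ℕ → Discovery} {T : ℕ} {D : List ℕ}
    (hT : state ω T = ⟨D, D, D⟩) (h₀ : ω T = .selfish) (h₁ : ω (T + 1) = .selfish) {s t : ℕ}
    (hst : s ≤ t) (ht : 2 ≤ walk ω (T + 2) t) :
    (state ω (T + 2 + s)).secret <:+ (state ω (T + 2 + t)).secret := by
  induction t, hst using Nat.le_induction with
  | base => exact List.suffix_rfl
  | succ t _ ih =>
    have hw := two_le_walk_of_succ (t := t) (by omega : walk ω (T + 2) (t + 1) ≠ 0)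
    refine (ih hw).trans ?_
    rw [← Nat.add_assoc]
    by_cases hω : ω (T + 2 + t) = .selfish
    · rw [state_succ, hω, State.next, State.afterSelfish]
      split_ifs <;> exact List.suffix_cons _ _
    · rw [excursion_secret_succ hT h₀ h₁ hw hω]

/-! ### Uncles and nephews after two selfish blocks -/

/-- The first attack cycle when it starts with two blocks of the selfish miner. -/
lemma fork_cycle {ω : ℕ → Discovery} (hω : ∀ m, ∃ t, walk ω m t < 2) (h₀ : ω 0 = .selfish)
    (h₁ : ω 1 = .selfish) :
    ∃ (e : ℕ) (D : List ℕ), state ω (2 + e + 1) = ⟨D, D, D⟩ ∧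
      (∀ u, u ∈ cycleBlocks ω ↔ u < 2 + e + 1) ∧
      (∀ b < 2 + e + 1, Official ω b ↔ ω b = .selfish) ∧
      (∀ t, 2 ≤ walk ω 2 t ↔ t ≤ e) ∧
      ∀ t ≤ e, (state ω (2 + t)).secret <:+ D := by
  obtain ⟨e, he, hωe⟩ := exists_walk_end (hω 2)
  have hT : state ω 0 = ⟨[], [], []⟩ := rfl
  have hend := excursion_end hT h₀ h₁ (t := e) (by simpa using he) (by simpa using hωe)
  simp only [Nat.zero_add] at hend
  -- The honest block `2 + e` takes the lead from two to one, and a lead below two never recovers.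
  have hwalk : ∀ t, 2 ≤ walk ω 2 t ↔ t ≤ e := by
    refine fun t => ⟨fun h => ?_, fun h => two_le_walk_of_le h he.ge⟩
    by_contra h2
    have h3 : 2 ≤ walk ω 2 (e + 1) := two_le_walk_of_le (by omega) h
    have := walk_honest he.ge hωe
    omega
  refine ⟨e, _, hend, fun u => ⟨fun h => ?_, fun h s hs hsu hsync => ?_⟩, fun b hb => ?_, hwalk,
    fun t ht => ?_⟩
  · by_contra h2
    refine h (2 + e + 1) (by omega) (by omega) ?_
    rw [hend]
    rfl
  · obtain rfl | ⟨r, rfl⟩ : s = 1 ∨ ∃ r, s = 2 + r := by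
      rcases Nat.lt_or_ge s 2 with h | h
      · exact Or.inl (by omega)
      · exact Or.inr ⟨s - 2, by omega⟩
    · have : state ω 1 = ⟨[0], [], []⟩ := by
        simp [state, h₀, State.next, State.afterSelfish]
      simp [this, State.Synced] at hsync
    · have hr := (hwalk r).2 (by omega)
      have i1 := (excursion hT h₀ h₁ (t := r) (by simpa using hr)).1
      simp only [Nat.zero_add] at i1
      rw [State.Synced] at hsync
      rw [hsync] at i1
      omega
  · rw [official_iff_mem hend hb]
    have i3 := (excursion hT h₀ h₁ (t := e) (by simpa using he.ge)).2.2.1 b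
    simp only [Nat.zero_add] at i3
    rw [i3]
    constructor
    · rintro (h | h)
      · simp at h
      · exact h.2.2
    · refine fun h => Or.inr ⟨Nat.zero_le _, ?_, h⟩
      by_contra h2
      exact hωe (by rwa [show 2 + e = b by omega])
  · have := excursion_secret_suffix hT h₀ h₁ ht (by simpa using he.ge)
    simpa only [Nat.zero_add] using this

/-- In a cycle which starts with two blocks of the selfish miner, block `2 + t` is an uncle, found
when the lead of the selfish miner is `i + 2`. -/
def forkUncle (t i : ℕ) : Set (ℕ → Discovery) :=
  {ω | (ω 0 = .selfish ∧ ω 1 = .selfish) ∧ walk ω 2 t = i + 2 ∧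
    (ω (2 + t) = .honestOnSelfish ∨ ω (2 + t) = .honestOnHonest ∧ i = t)}

/-- Moreover, the cycle ends without any further block of the selfish miner, and the next official
block is found by an honest miner. -/
def forkUncleHonest (t i : ℕ) : Set (ℕ → Discovery) :=
  {ω | (ω ∈ forkUncle t i ∧ ∀ j < i, ω (2 + t + 1 + j) ≠ .selfish) ∧
    HonestFirst ω (2 + t + 1 + i)}

/-- Block `u` is a referred uncle of the first cycle. -/
def uncleEvent (n₁ : ℕ) : ℕ → Set (ℕ → Discovery)
  | 0 => {ω | ω 0 = .selfish ∧ ω 1 ≠ .selfish ∧ ω 2 = .honestOnHonest}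
  | 1 => {ω | ω 0 = .selfish ∧ ω 1 ≠ .selfish ∧ ω 2 ≠ .honestOnHonest}
  | t + 2 => ⋃ i ∈ Finset.range (n₁ - 1), forkUncle t i

/-- Block `u` is an uncle of the first cycle to which an honest nephew refers. -/
def uncleHonestEvent (n₁ : ℕ) : ℕ → Set (ℕ → Discovery)
  | 0 => {ω | ω 0 = .selfish ∧ ω 1 ≠ .selfish ∧ ω 2 = .honestOnHonest}
  | 1 => {ω | ω 0 = .selfish ∧ ω 1 ≠ .selfish ∧ ω 2 = .honestOnSelfish}
  | t + 2 => ⋃ i ∈ Finset.range (n₁ - 1), forkUncleHonest t i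

lemma eq_honestOnSelfish_or {x : Discovery} (h : x ≠ .selfish) :
    x = .honestOnSelfish ∨ x = .honestOnHonest := by
  cases x <;> simp_all

section Fork

variable {ω : ℕ → Discovery}

/-- The state in a cycle which starts with two blocks of the selfish miner. -/
lemma fork_state (h₀ : ω 0 = .selfish) (h₁ : ω 1 = .selfish) {t : ℕ} (ht : 2 ≤ walk ω 2 t) :
    (state ω (2 + t)).secret.length = (state ω (2 + t)).honest.length + walk ω 2 t ∧
      (state ω (2 + t)).secret.length + (state ω (2 + t)).honest.length = t + 2 ∧
      (∀ b, b ∈ (state ω (2 + t)).secret ↔ b < 2 + t ∧ ω b = .selfish) ∧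
      ((state ω (2 + t)).honest = [] ∨
        ∃ b r, (state ω (2 + t)).honest = b :: r ∧ ω b ≠ .selfish) := by
  have := excursion (ω := ω) (T := 0) (D := []) rfl h₀ h₁ (t := t) (by simpa using ht)
  simpa using this

/-- The chain of the selfish miner, when block `2 + t` is found with a lead `i + 2`, ends up
below an official block. -/
lemma fork_next_official (hω : ∀ m, ∃ t, walk ω m t < 2) (h₀ : ω 0 = .selfish)
    (h₁ : ω 1 = .selfish) {t i : ℕ} (ht : walk ω 2 t = i + 2) (hu : ω (2 + t) ≠ .selfish) :
    ∃ n, 2 + t < n ∧ Official ω n ∧ ancestors ω n = (state ω (2 + t)).secret ∧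
      (ω n ≠ .selfish ↔
        (∀ j < i, ω (2 + t + 1 + j) ≠ .selfish) ∧ HonestFirst ω (2 + t + 1 + i)) := by
  have hT : state ω 0 = ⟨[], [], []⟩ := rfl
  have hrun := fun (j : ℕ) hj hl => excursion_run hT h₀ h₁ (t := t) (i := i) (j := j)
    (by simpa using ht) hj (by simpa using hl)
  simp only [Nat.zero_add] at hrun
  -- Counting block `2 + t` itself, `i + 1` honest discoveries bring the lead from `i + 2` to one.
  -- If all of them are honest, the cycle ends on the unchanged fork and `n` is found after its end.
  -- Otherwise the first selfish block among them is mined on this very fork.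
  by_cases h : ∀ j < i + 1, ω (2 + t + j) ≠ .selfish
  · obtain ⟨e1, e2⟩ := hrun i (by omega) (fun l hl => h l (by omega))
    have hend := excursion_end hT h₀ h₁ (t := t + i) (by simpa using (by omega))
      (by simpa [Nat.add_assoc] using h i (by omega))
    simp only [Nat.zero_add] at hend
    rw [← Nat.add_assoc, e2] at hend
    obtain ⟨n, hn, h2, h3, h4⟩ := exists_next_official hω hend
    refine ⟨n, by omega, h2, h3, ?_⟩
    rw [h4, show 2 + t + 1 + i = 2 + t + i + 1 by omega]
    refine (and_iff_right ?_).symm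
    intro j hj
    have := h (j + 1) (by omega)
    rwa [show 2 + t + 1 + j = 2 + t + (j + 1) by omega]
  · classical
    push Not at h
    have hspec := Nat.find_spec h
    have hmin := fun j => Nat.find_min h (m := j)
    generalize Nat.find h = j at *
    obtain ⟨hj, hj2⟩ := hspec
    have hl : ∀ l < j, ω (2 + t + l) ≠ .selfish := fun l hl hl2 =>
      hmin l hl ⟨by omega, hl2⟩
    obtain ⟨e1, e2⟩ := hrun j (by omega) hl
    have hj0 : j ≠ 0 := by
      rintro rfl
      exact hu hj2
    obtain ⟨e, D, -, -, h3, h4, -⟩ := fork_cycle hω h₀ h₁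
    have he := (h4 (t + j)).1 (by omega)
    refine ⟨2 + t + j, by omega, (h3 _ (by omega)).2 hj2, ?_, ?_⟩
    · rw [← e2, ancestors, hj2]
      rfl
    · refine ⟨fun h => absurd hj2 h, fun h => absurd hj2 ?_⟩
      have := h.1 (j - 1) (by omega)
      rwa [show 2 + t + 1 + (j - 1) = 2 + t + j by omega] at this

/-- The uncles in a cycle which starts with two blocks of the selfish miner. -/
lemma fork_isUncle_iff (hω : ∀ m, ∃ t, walk ω m t < 2) (h₀ : ω 0 = .selfish)
    (h₁ : ω 1 = .selfish) {t i : ℕ} (ht : walk ω 2 t = i + 2) :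
    IsUncle ω (2 + t) ↔
      ω (2 + t) = .honestOnSelfish ∨ ω (2 + t) = .honestOnHonest ∧ i = t := by
  obtain ⟨e, D, -, -, h3, h4, -⟩ := fork_cycle hω h₀ h₁
  have he := (h4 t).1 (by omega)
  obtain ⟨i1, i2, i3, i4⟩ := fork_state h₀ h₁ (t := t) (by omega)
  obtain ⟨p1, p2⟩ := state_published ω (2 + t)
  rw [IsUncle, h3 _ (by omega), parent?, ancestors]
  cases hx : ω (2 + t) with
  | selfish => simp
  | honestOnSelfish =>
    simp only [State.parentChain, reduceCtorEq, not_false_eq_true, true_and, false_and, or_false,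
      iff_true]
    intro v hv
    obtain ⟨hv1, hv2⟩ := (i3 v).1 (p2.subset (List.mem_of_mem_head? hv))
    exact (h3 v (by omega)).2 hv2
  | honestOnHonest =>
    simp only [State.parentChain, reduceCtorEq, not_false_eq_true, true_and, false_or]
    constructor
    · intro h
      -- The heights of the fork and of the honest chain differ by `i + 2` and sum to `t + 2`, so an
      -- empty honest chain means `i = t`. A nonempty one has an honest tip, which is not official.
      rcases i4 with i4 | ⟨b, r, hb, hb2⟩
      · rw [i4, List.length_nil] at i1 i2
        omega
      · rw [hb] at h
        have := (state_lt ω (2 + t)).2.2 b (by simp [hb])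
        exact absurd ((h3 b (by omega)).1 (h b (by simp))) hb2
    · intro h
      have : (state ω (2 + t)).honest = [] := by
        rw [← List.length_eq_zero_iff]
        omega
      simp [this]

/-- The nephew is the first official block above the fork as it stands when the uncle is found. Its
height exceeds that of the uncle by `i + 2 ≤ n₁`, and its ancestors are all older than the uncle, so
none has referred to it before. -/
lemma forkUncle_referred (hω : ∀ m, ∃ t, walk ω m t < 2) {n₁ t i : ℕ} (hi : i < n₁ - 1)
    (h : ω ∈ forkUncle t i) :
    2 + t ∈ cycleBlocks ω ∧ IsUncle ω (2 + t) ∧ ∃ n, Official ω n ∧ Refers n₁ ω n (2 + t) ∧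
      (ω n ≠ .selfish ↔ ω ∈ forkUncleHonest t i) := by
  have h' := h
  obtain ⟨⟨h₀, h₁⟩, ht, htype⟩ := h
  have hu : ω (2 + t) ≠ .selfish := by
    rcases htype with h | h
    · simp [h]
    · simp [h.1]
  obtain ⟨e, D, -, h2, h3, h4, -⟩ := fork_cycle hω h₀ h₁
  have he := (h4 t).1 (by omega)
  obtain ⟨i1, i2, i3, i4⟩ := fork_state h₀ h₁ (t := t) (by omega)
  obtain ⟨p1, p2⟩ := state_published ω (2 + t)
  obtain ⟨n, hn, hn2, hn3, hn4⟩ := fork_next_official hω h₀ h₁ ht hu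
  refine ⟨(h2 _).2 (by omega), (fork_isUncle_iff hω h₀ h₁ ht).2 htype, n, hn2, ?_, ?_⟩
  · have hlen := length_parentChain (ω := ω) (t := 2 + t) hu
    refine Eligible.refers ⟨hn, Or.inr (Or.inl hu), ?_, ?_, ?_, ?_⟩ ?_
    · rw [hn3, i3]
      exact fun h => hu h.2
    · intro v hv
      rw [hn3]
      rw [parent?, ancestors] at hv
      rcases htype with h | ⟨h, hit⟩ <;> rw [h] at hv
      · exact p2.subset (List.mem_of_mem_head? hv)
      · have : (state ω (2 + t)).honest = [] := by
          rw [← List.length_eq_zero_iff]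
          omega
        simp [State.parentChain, this] at hv
    · rw [height, height, hn3, ancestors, hlen]
      omega
    · rw [height, height, hn3, ancestors, hlen]
      omega
    · intro m hm
      rw [hn3, i3] at hm
      omega
  · rw [hn4]
    simp [forkUncleHonest, h']

/-- A nephew is newer than the uncle, hence not in the fork of that moment, hence above it: the
distance is at least `i + 2`, which forces `i < n₁ - 1`. -/
lemma mem_forkUncle_of_referred (hω : ∀ m, ∃ t, walk ω m t < 2) (h₀ : ω 0 = .selfish)
    (h₁ : ω 1 = .selfish) {n₁ u n : ℕ} (hu : u ∈ cycleBlocks ω) (hu2 : IsUncle ω u)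
    (hn : Official ω n) (hnu : Refers n₁ ω n u) :
    ∃ t i, u = t + 2 ∧ i < n₁ - 1 ∧ ω ∈ forkUncle t i := by
  obtain ⟨e, D, h1, h2, h3, h4, h5⟩ := fork_cycle hω h₀ h₁
  have hue := (h2 u).1 hu
  have hωu : ω u ≠ .selfish := fun h => hu2.1 ((h3 u hue).2 h)
  obtain ⟨t, rfl⟩ : ∃ t, u = 2 + t := by
    refine ⟨u - 2, ?_⟩
    rcases u with _ | _ | u
    · exact absurd h₀ hωu
    · exact absurd h₁ hωu
    · omega
  have hw := (h4 t).2 (by omega)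
  obtain ⟨i, hi⟩ := Nat.exists_eq_add_of_le' hw
  refine ⟨t, i, by omega, ?_, ⟨h₀, h₁⟩, hi, (fork_isUncle_iff hω h₀ h₁ hi).1 hu2⟩
  obtain ⟨i1, -, i3, -⟩ := fork_state h₀ h₁ hw
  have hel := hnu.eligible
  have hlt := length_lt_height (T := 2 + e + 1) (n := n) (by rw [h1]; rfl)
    (by rw [h1]; exact h5 t (by omega)) hn (fun m hm => ((i3 m).1 hm).1.trans hel.1)
  have hle := hel.2.2.2.2.2
  have hlen := length_parentChain (ω := ω) (t := 2 + t) hωu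
  rw [height, height, ancestors, ancestors, hlen] at hle
  rw [height, ancestors] at hlt
  omega

end Fork

/-! ### Cycles of three blocks with a competition -/

section Competition

variable {ω : ℕ → Discovery}

/-- The first attack cycle when a block of the selfish miner is followed by one of the honest
miners. -/
lemma competition_cycle (h₀ : ω 0 = .selfish) (h₁ : ω 1 ≠ .selfish) :
    ∃ D, state ω 3 = ⟨D, D, D⟩ ∧ (∀ u, u ∈ cycleBlocks ω ↔ u < 3) ∧
      D = 2 :: ancestors ω 2 ∧ ancestors ω 0 = [] ∧ ancestors ω 1 = [] ∧
      ((ω 2 = .honestOnHonest ∧ ancestors ω 2 = [1]) ∨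
        (ω 2 ≠ .honestOnHonest ∧ ancestors ω 2 = [0])) ∧ 0 ∈ (state ω 2).published := by
  have hT : state ω 0 = ⟨[], [], []⟩ := rfl
  have e1 : state ω 1 = ⟨[0], [], []⟩ := by
    simp [state, h₀, State.next, State.afterSelfish]
  have e2 := state_competition hT h₀ h₁
  have e3 := state_competition_end hT h₀ h₁
  simp only [Nat.zero_add] at e2 e3
  refine ⟨_, e3, fun u => ⟨fun h => ?_, fun h s hs hsu hsync => ?_⟩, rfl, ?_, ?_, ?_, ?_⟩
  · by_contra h2
    refine h 3 (by omega) (by omega) ?_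
    rw [e3]
    rfl
  · obtain rfl | rfl : s = 1 ∨ s = 2 := by omega
    · simp [e1, State.Synced] at hsync
    · simp [e2, State.Synced] at hsync
  · rw [ancestors, hT]
    cases ω 0 <;> rfl
  · rw [ancestors, e1]
    rcases eq_honestOnSelfish_or h₁ with h | h <;> rw [h] <;> rfl
  · rw [ancestors, e2]
    cases ω 2 <;> simp [State.parentChain]
  · simp [e2]

lemma competition_uncle_iff (h₀ : ω 0 = .selfish) (h₁ : ω 1 ≠ .selfish) {u : ℕ} :
    (u ∈ cycleBlocks ω ∧ IsUncle ω u) ↔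
      (u = 0 ∧ ω 2 = .honestOnHonest) ∨ (u = 1 ∧ ω 2 ≠ .honestOnHonest) := by
  obtain ⟨D, h1, h2, h3, h4, h5, h6, -⟩ := competition_cycle h₀ h₁
  rw [h2]
  constructor
  · rintro ⟨hu, hu2⟩
    have := hu2.1
    rw [official_iff_mem h1 hu, h3] at this
    rcases h6 with ⟨h6, h7⟩ | ⟨h6, h7⟩ <;> rw [h7] at this <;> simp at this <;>
      simp [h6] <;> omega
  · rintro (⟨rfl, h⟩ | ⟨rfl, h⟩)
    · refine ⟨by omega, ?_, by simp [parent?, h4]⟩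
      rw [official_iff_mem h1 (by omega), h3]
      rcases h6 with ⟨h6, h7⟩ | ⟨h6, h7⟩
      · simp [h7]
      · exact absurd h h6
    · refine ⟨by omega, ?_, by simp [parent?, h5]⟩
      rw [official_iff_mem h1 (by omega), h3]
      rcases h6 with ⟨h6, h7⟩ | ⟨h6, h7⟩
      · exact absurd h6 h
      · simp [h7]

lemma competition_refers (h₀ : ω 0 = .selfish) (h₁ : ω 1 ≠ .selfish) {n₁ u : ℕ}
    (hn₁ : 1 ≤ n₁)
    (hu : (u = 0 ∧ ω 2 = .honestOnHonest) ∨ (u = 1 ∧ ω 2 ≠ .honestOnHonest)) :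
    Official ω 2 ∧ Refers n₁ ω 2 u := by
  obtain ⟨D, h1, h2, h3, h4, h5, h6, h7⟩ := competition_cycle h₀ h₁
  refine ⟨⟨3, by rw [h1]; rfl, by simp [h1, h3]⟩, ?_⟩
  rcases hu with ⟨rfl, hu⟩ | ⟨rfl, hu⟩ <;> rcases h6 with ⟨h6, h8⟩ | ⟨h6, h8⟩
  -- The ancestor `1` is newer than the uncle `0`, so `Eligible.refers` does not apply; but these
  -- two blocks have the same height, so `1` cannot refer to `0`.
  · rw [Refers]
    refine ⟨⟨by omega, Or.inr (Or.inr ⟨2, le_rfl, h7⟩), by simp [h8], by simp [parent?, h4],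
      by simp [height, h4, h8], by simp [height, h4, h8]; omega⟩, fun m _ hm hmu => ?_⟩
    have hel := hmu.eligible
    rw [h8, List.mem_singleton] at hm
    subst hm
    simpa [height, h4, h5] using hel.2.2.2.2.1
  · exact absurd hu h6
  · exact absurd h6 hu
  · exact Eligible.refers ⟨by omega, Or.inr (Or.inl h₁), by simp [h8], by simp [parent?, h5],
      by simp [height, h5, h8], by simp [height, h5, h8]; omega⟩ (by simp [h8])

end Competition

/-! ### Referred uncles as events on the discoveries -/

/-- The referred uncles of the first cycle. -/
theorem referred_uncle_iff {ω : ℕ → Discovery} (hω : ∀ m, ∃ t, walk ω m t < 2) {n₁ : ℕ}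
    (hn₁ : 1 ≤ n₁) (u : ℕ) :
    (u ∈ cycleBlocks ω ∧ IsUncle ω u ∧ ∃ n, Official ω n ∧ Refers n₁ ω n u) ↔
      ω ∈ uncleEvent n₁ u := by
  by_cases h₀ : ω 0 = .selfish
  · by_cases h₁ : ω 1 = .selfish
    · constructor
      · rintro ⟨h1, h2, n, h3, h4⟩
        obtain ⟨t, i, rfl, hi, hE⟩ := mem_forkUncle_of_referred hω h₀ h₁ h1 h2 h3 h4
        exact Set.mem_biUnion (Finset.mem_coe.2 (Finset.mem_range.2 hi)) hE
      · intro h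
        rcases u with _ | _ | t
        · exact absurd h₁ h.2.1
        · exact absurd h₁ h.2.1
        · simp only [uncleEvent, Set.mem_iUnion, Finset.mem_range] at h
          obtain ⟨i, hi, hE⟩ := h
          obtain ⟨h1, h2, n, h3, h4, -⟩ := forkUncle_referred hω hi hE
          rw [Nat.add_comm 2 t] at h1 h2 h4
          exact ⟨h1, h2, n, h3, h4⟩
    · rw [← and_assoc, competition_uncle_iff h₀ h₁]
      have : ω ∈ uncleEvent n₁ u ↔
          (u = 0 ∧ ω 2 = .honestOnHonest) ∨ (u = 1 ∧ ω 2 ≠ .honestOnHonest) := by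
        rcases u with _ | _ | t
        · simp [uncleEvent, h₀, h₁]
        · simp [uncleEvent, h₀, h₁]
        · simp [uncleEvent, forkUncle, h₁]
      rw [this]
      exact ⟨fun h => h.1, fun h => ⟨h, 2, competition_refers h₀ h₁ hn₁ h⟩⟩
  · constructor
    · rintro ⟨h1, h2, -⟩
      have e1 := state_one_honest (ω := ω) (T := 0) (D := []) rfl h₀
      simp only [Nat.zero_add] at e1
      have hu : u = 0 := by
        by_contra hu
        refine h1 1 le_rfl (by omega) ?_
        rw [e1]
        rfl
      subst hu
      exact absurd ⟨1, by rw [e1]; rfl, by simp [e1]⟩ h2.1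
    · intro h
      rcases u with _ | _ | t
      · exact absurd h.1 h₀
      · exact absurd h.1 h₀
      · simp [uncleEvent, forkUncle, h₀] at h

lemma forkUncle_lead_unique {ω : ℕ → Discovery} {t i i' : ℕ} (h : ω ∈ forkUncle t i)
    (h' : ω ∈ forkUncle t i') : i = i' := by
  have h1 := h.2.1
  have h2 := h'.2.1
  omega

/-- By `nephew_unique`, a single nephew whose miner is identified determines the miner of every
nephew of `u`; this separates honest from selfish references. -/
lemma exists_nephew {ω : ℕ → Discovery} (hω : ∀ m, ∃ t, walk ω m t < 2) {n₁ : ℕ}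
    (hn₁ : 1 ≤ n₁) {u : ℕ} (h : ω ∈ uncleEvent n₁ u) :
    ∃ n, Official ω n ∧ Refers n₁ ω n u ∧ (ω n ≠ .selfish ↔ ω ∈ uncleHonestEvent n₁ u) := by
  rcases u with _ | _ | t
  · obtain ⟨h1, h2⟩ := competition_refers (u := 0) h.1 h.2.1 hn₁ (Or.inl ⟨rfl, h.2.2⟩)
    exact ⟨2, h1, h2, by simp [uncleHonestEvent, h.1, h.2.1, h.2.2]⟩
  · obtain ⟨h1, h2⟩ := competition_refers (u := 1) h.1 h.2.1 hn₁ (Or.inr ⟨rfl, h.2.2⟩)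
    refine ⟨2, h1, h2, ?_⟩
    have := h.2.2
    cases hx : ω 2 <;> simp_all [uncleHonestEvent, h.1, h.2.1]
  · simp only [uncleEvent, Set.mem_iUnion, Finset.mem_range] at h
    obtain ⟨i, hi, hE⟩ := h
    obtain ⟨-, -, n, h3, h4, h5⟩ := forkUncle_referred hω hi hE
    refine ⟨n, h3, Nat.add_comm 2 t ▸ h4, ?_⟩
    rw [h5]
    simp only [uncleHonestEvent, Set.mem_iUnion, Finset.mem_range]
    refine ⟨fun h => ⟨i, hi, h⟩, ?_⟩
    rintro ⟨i', -, h⟩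
    rwa [forkUncle_lead_unique hE h.1.1]

lemma uncleHonestEvent_subset (n₁ u : ℕ) : uncleHonestEvent n₁ u ⊆ uncleEvent n₁ u := by
  rcases u with _ | _ | t
  · exact subset_rfl
  · exact fun ω h => ⟨h.1, h.2.1, by simp [h.2.2]⟩
  · exact Set.biUnion_mono subset_rfl fun i _ ω h => h.1.1

/-- The uncles of the first cycle with an honest nephew. -/
theorem referred_uncle_honest_iff {ω : ℕ → Discovery} (hω : ∀ m, ∃ t, walk ω m t < 2) {n₁ : ℕ}
    (hn₁ : 1 ≤ n₁) (u : ℕ) :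
    (u ∈ cycleBlocks ω ∧ IsUncle ω u ∧
        ∃ n, Official ω n ∧ ω n ≠ .selfish ∧ Refers n₁ ω n u) ↔ ω ∈ uncleHonestEvent n₁ u := by
  constructor
  · rintro ⟨h1, h2, n, h3, h4, h5⟩
    obtain ⟨m, hm, hmu, hiff⟩ :=
      exists_nephew hω hn₁ ((referred_uncle_iff hω hn₁ u).1 ⟨h1, h2, n, h3, h5⟩)
    rw [← hiff, ← nephew_unique h3 hm h5 hmu]
    exact h4
  · intro h
    have hE := uncleHonestEvent_subset n₁ u h
    obtain ⟨h1, h2, -⟩ := (referred_uncle_iff hω hn₁ u).2 hE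
    obtain ⟨m, hm, hmu, hiff⟩ := exists_nephew hω hn₁ hE
    exact ⟨h1, h2, m, hm, hiff.2 h, hmu⟩

/-! ### Events decided by finitely many discoveries, and independence -/

section Law

open ProbabilityTheory

instance : Finite Discovery :=
  Finite.of_surjective (fun i : Fin 3 => ![Discovery.selfish, .honestOnSelfish, .honestOnHonest] i)
    fun d => by
      cases d
      · exact ⟨0, rfl⟩
      · exact ⟨1, rfl⟩
      · exact ⟨2, rfl⟩

instance : DiscreteMeasurableSpace Discovery := ⟨fun _ => trivial⟩

variable {q γ : ℝ}

lemma discoveryLaw_isProbabilityMeasure (hq₀ : 0 ≤ q) (hq₁ : q ≤ 1) (hγ₀ : 0 ≤ γ)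
    (hγ₁ : γ ≤ 1) : IsProbabilityMeasure (discoveryLaw q γ) := by
  constructor
  have h1 : 0 ≤ (1 - q) * γ := mul_nonneg (by linarith) hγ₀
  have h2 : 0 ≤ (1 - q) * (1 - γ) := mul_nonneg (by linarith) (by linarith)
  simp only [discoveryLaw, Measure.add_apply, Measure.smul_apply, measure_univ, smul_eq_mul,
    mul_one]
  rw [← ENNReal.ofReal_add hq₀ h1, ← ENNReal.ofReal_add (by positivity) h2,
    ← ENNReal.ofReal_one]
  congr 1
  ring

open Classical in
lemma discoveryLaw_real (hq₀ : 0 ≤ q) (hq₁ : q ≤ 1) (hγ₀ : 0 ≤ γ) (hγ₁ : γ ≤ 1)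
    (B : Set Discovery) :
    (discoveryLaw q γ).real B = (if .selfish ∈ B then q else 0) +
      (if .honestOnSelfish ∈ B then (1 - q) * γ else 0) +
      (if .honestOnHonest ∈ B then (1 - q) * (1 - γ) else 0) := by
  have h1 : 0 ≤ (1 - q) * γ := mul_nonneg (by linarith) hγ₀
  have h2 : 0 ≤ (1 - q) * (1 - γ) := mul_nonneg (by linarith) (by linarith)
  rw [measureReal_def, discoveryLaw, Measure.add_apply, Measure.add_apply,
    ENNReal.toReal_add, ENNReal.toReal_add]
  · simp only [Measure.smul_apply, Measure.dirac_apply, smul_eq_mul, Set.indicator_apply]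
    split_ifs <;> simp [hq₀, h1, h2]
  all_goals
    simp only [Measure.smul_apply, Measure.dirac_apply, smul_eq_mul, Set.indicator_apply]
    split_ifs <;> simp

/-- Membership in `E` is decided by the discoveries before block `m`. -/
def DeterminedBefore (m : ℕ) (E : Set (ℕ → Discovery)) : Prop :=
  ∀ ω ω', (∀ i < m, ω i = ω' i) → (ω ∈ E ↔ ω' ∈ E)

lemma DeterminedBefore.mono {m n : ℕ} {E : Set (ℕ → Discovery)} (h : DeterminedBefore m E)
    (hmn : m ≤ n) : DeterminedBefore n E :=
  fun ω ω' hω => h ω ω' fun i hi => hω i (hi.trans_le hmn)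

lemma DeterminedBefore.inter {m : ℕ} {E F : Set (ℕ → Discovery)} (h : DeterminedBefore m E)
    (h' : DeterminedBefore m F) : DeterminedBefore m (E ∩ F) :=
  fun ω ω' hω => and_congr (h ω ω' hω) (h' ω ω' hω)

lemma DeterminedBefore.coord {m i : ℕ} (hi : i < m) (B : Set Discovery) :
    DeterminedBefore m {ω | ω i ∈ B} := by
  intro ω ω' hω
  simp only [Set.mem_ofPred_eq, hω i hi]

/-- Such an event comes from a subset of a finite product of finite sets, so measurability is
automatic and independence reduces to that of finite families of coordinates. -/
lemma DeterminedBefore.exists_preimage {m : ℕ} {E : Set (ℕ → Discovery)}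
    (h : DeterminedBefore m E) : ∃ A : Set (Finset.range m → Discovery),
      E = (fun ω (i : Finset.range m) => ω i) ⁻¹' A := by
  refine ⟨(fun ω (i : Finset.range m) => ω i) '' E,
    Set.Subset.antisymm (Set.subset_preimage_image _ _) ?_⟩
  rintro ω ⟨ω', hω', he⟩
  exact (h ω' ω fun i hi => congrFun he ⟨i, Finset.mem_range.2 hi⟩).1 hω'

lemma measurable_restrict_range (m : ℕ) :
    Measurable fun (ω : ℕ → Discovery) (i : Finset.range m) => ω i :=
  measurable_pi_lambda _ fun _ => measurable_pi_apply _

lemma DeterminedBefore.measurableSet {m : ℕ} {E : Set (ℕ → Discovery)}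
    (h : DeterminedBefore m E) : MeasurableSet E := by
  obtain ⟨A, rfl⟩ := h.exists_preimage
  exact measurable_restrict_range m (Set.toFinite A).measurableSet

/-- The discovery of block `m` is independent of the past. -/
lemma DeterminedBefore.real_inter [IsProbabilityMeasure (discoveryLaw q γ)] {m : ℕ}
    {E : Set (ℕ → Discovery)} (h : DeterminedBefore m E) (B : Set Discovery) :
    (miningLaw q γ).real (E ∩ {ω | ω m ∈ B}) =
      (miningLaw q γ).real E * (discoveryLaw q γ).real B := by
  obtain ⟨A, rfl⟩ := h.exists_preimage
  have hind : iIndepFun (fun (i : ℕ) (ω : ℕ → Discovery) => ω i) (miningLaw q γ) :=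
    iIndepFun_infinitePi (X := fun _ => id) fun _ => measurable_id
  have hfin := hind.indepFun_finset (Finset.range m) {m} (by simp)
    fun i => measurable_pi_apply i
  have := hfin.measure_inter_preimage_eq_mul A
    {f | f ⟨m, Finset.mem_singleton_self m⟩ ∈ B}
    (Set.toFinite A).measurableSet (Set.toFinite _).measurableSet
  have hB : (miningLaw q γ) {ω | ω m ∈ B} = discoveryLaw q γ B := by
    have := (measurePreserving_eval_infinitePi (fun _ : ℕ => discoveryLaw q γ) m).measure_preimage
      (s := B) MeasurableSet.of_discrete.nullMeasurableSet
    exact this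
  rw [measureReal_def, measureReal_def, measureReal_def, ← ENNReal.toReal_mul, ← hB]
  congr 1

end Law

/-! ### Distribution of the lead and expected number of visits -/

/-- The probability `walkProb q t j` that the lead of the selfish miner, which was two, is `j + 2`
after `t` further discoveries, without having dropped below two. -/
def walkProb (q : ℝ) : ℕ → ℕ → ℝ
  | 0, 0 => 1
  | 0, _ + 1 => 0
  | t + 1, 0 => (1 - q) * walkProb q t 1
  | t + 1, j + 1 => q * walkProb q t j + (1 - q) * walkProb q t (j + 2)

section WalkProb

variable {q : ℝ}

lemma walkProb_nonneg (hq₀ : 0 ≤ q) (hq₁ : q ≤ 1) (t j : ℕ) : 0 ≤ walkProb q t j := by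
  have hp : 0 ≤ 1 - q := by linarith
  induction t generalizing j with
  | zero => cases j <;> simp [walkProb]
  | succ t ih =>
    cases j with
    | zero => exact mul_nonneg hp (ih 1)
    | succ j => exact add_nonneg (mul_nonneg hq₀ (ih _)) (mul_nonneg hp (ih _))

lemma walkProb_eq_zero {t j : ℕ} (h : t < j) : walkProb q t j = 0 := by
  induction t generalizing j with
  | zero =>
    obtain ⟨j, rfl⟩ := Nat.exists_eq_add_of_lt h
    simp [walkProb]
  | succ t ih =>
    obtain ⟨j, rfl⟩ : ∃ i, j = i + 1 := ⟨j - 1, by omega⟩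
    rw [walkProb, ih (by omega), ih (by omega)]
    ring

/-- The lead reaches `t + 2` after `t` discoveries only if all are selfish. This is the case in
which the honest branch is still empty. -/
lemma walkProb_self (t : ℕ) : walkProb q t t = q ^ t := by
  induction t with
  | zero => simp [walkProb]
  | succ t ih =>
    rw [walkProb, ih, walkProb_eq_zero (by omega)]
    ring

/-- The bound `r ^ t * y ^ j` is a supersolution of the recursion as soon as `q + (1 - q) y² ≤ r y`
and `(1 - q) y ≤ r`. A rate `r < 1` is possible when `y` lies strictly between the roots `q / (1 -
q)` and `1` of `(1 - q) y² - y + q`; the `y` taken here is their midpoint, and `r` gives equality in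
the first condition. -/
lemma walkProb_le (hq₀ : 0 ≤ q) (hq : q < 1 / 2) (t j : ℕ) :
    walkProb q t j ≤ (2 * (1 - q) * q + 1 / 2) ^ t * (1 / (2 * (1 - q))) ^ j := by
  have hp : 0 < 1 - q := by linarith
  set r := 2 * (1 - q) * q + 1 / 2 with hr
  set y := 1 / (2 * (1 - q)) with hy
  have hr₀ : 0 ≤ r := by positivity
  have hy₀ : 0 < y := by positivity
  have hpy : (1 - q) * y = 1 / 2 := by
    rw [hy]
    field_simp
  have hry : r * y = q + (1 - q) * y ^ 2 := by
    rw [hr, hy]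
    field_simp
  induction t generalizing j with
  | zero =>
    cases j with
    | zero => simp [walkProb]
    | succ j =>
      simp only [walkProb, pow_zero, one_mul]
      positivity
  | succ t ih =>
    cases j with
    | zero =>
      rw [walkProb]
      calc (1 - q) * walkProb q t 1 ≤ (1 - q) * (r ^ t * y ^ 1) := by gcongr; exact ih 1
        _ = r ^ t * ((1 - q) * y) := by ring
        _ ≤ r ^ t * r := by
          gcongr
          rw [hpy, hr]
          have : 0 ≤ 2 * (1 - q) * q := by positivity
          linarith
        _ = r ^ (t + 1) * y ^ 0 := by ring
    | succ j =>
      rw [walkProb]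
      calc q * walkProb q t j + (1 - q) * walkProb q t (j + 2)
          ≤ q * (r ^ t * y ^ j) + (1 - q) * (r ^ t * y ^ (j + 2)) := by
            gcongr
            · exact ih j
            · exact ih (j + 2)
        _ = r ^ t * y ^ j * (q + (1 - q) * y ^ 2) := by ring
        _ = r ^ (t + 1) * y ^ (j + 1) := by rw [← hry]; ring

lemma rate_lt_one (hq : q < 1 / 2) : 2 * (1 - q) * q + 1 / 2 < 1 := by
  nlinarith [sq_pos_of_pos (sub_pos.2 hq)]

lemma rate_nonneg (hq₀ : 0 ≤ q) (hq : q < 1 / 2) : 0 ≤ 2 * (1 - q) * q + 1 / 2 := by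
  have : 0 ≤ 1 - q := by linarith
  positivity

lemma summable_walkProb (hq₀ : 0 ≤ q) (hq : q < 1 / 2) (j : ℕ) :
    Summable fun t => walkProb q t j :=
  Summable.of_nonneg_of_le (fun t => walkProb_nonneg hq₀ (by linarith) t j)
    (fun t => walkProb_le hq₀ hq t j)
    ((summable_geometric_of_lt_one (rate_nonneg hq₀ hq) (rate_lt_one hq)).mul_right _)

/-- The expected number of visits of the lead `j + 2`. -/
lemma hasSum_walkProb (hq₀ : 0 ≤ q) (hq : q < 1 / 2) (j : ℕ) :
    HasSum (fun t => walkProb q t j) (1 / (1 - q) * (q / (1 - q)) ^ j) := by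
  have hp : 0 < 1 - q := by linarith
  set v : ℕ → ℝ := fun j => ∑' t, walkProb q t j with hv
  have hs := summable_walkProb hq₀ hq
  have h0 : v 0 = 1 + (1 - q) * v 1 := by
    simp only [hv]
    rw [(hs 0).tsum_eq_zero_add, ← tsum_mul_left]
    simp [walkProb]
  have hrec : ∀ j, v (j + 1) = q * v j + (1 - q) * v (j + 2) := by
    intro j
    simp only [hv]
    rw [(hs (j + 1)).tsum_eq_zero_add, ← tsum_mul_left, ← tsum_mul_left,
      ← ((hs j).mul_left q).tsum_add ((hs (j + 2)).mul_left (1 - q))]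
    simp [walkProb]
  -- The net flow between neighbouring leads does not depend on the level. It tends to zero at
  -- infinity, hence vanishes, and `v` is geometric.
  have hconst : ∀ j, (1 - q) * v (j + 1) - q * v j = (1 - q) * v 1 - q * v 0 := by
    intro j
    induction j with
    | zero => rfl
    | succ j ih => linarith [hrec j]
  -- Summing `walkProb_le` over time bounds `v j` by a constant times `y ^ j`, with `y < 1` because
  -- `q < 1 / 2`.
  have hlim : Filter.Tendsto v Filter.atTop (nhds 0) := by
    have hy : Filter.Tendsto (fun j : ℕ => (1 - (2 * (1 - q) * q + 1 / 2))⁻¹ *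
        (1 / (2 * (1 - q))) ^ j) Filter.atTop (nhds 0) := by
      rw [← mul_zero (1 - (2 * (1 - q) * q + 1 / 2))⁻¹]
      refine (tendsto_pow_atTop_nhds_zero_of_lt_one (by positivity) ?_).const_mul _
      rw [div_lt_one (by positivity)]
      linarith
    refine squeeze_zero (fun j => tsum_nonneg fun t => walkProb_nonneg hq₀ (by linarith) t j)
      (fun j => ?_) hy
    rw [← tsum_geometric_of_lt_one (rate_nonneg hq₀ hq) (rate_lt_one hq), ← tsum_mul_right]
    exact (hs j).tsum_le_tsum (fun t => walkProb_le hq₀ hq t j)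
      ((summable_geometric_of_lt_one (rate_nonneg hq₀ hq) (rate_lt_one hq)).mul_right _)
  have hc : (1 - q) * v 1 - q * v 0 = 0 := by
    have h1 : Filter.Tendsto (fun j => (1 - q) * v (j + 1) - q * v j) Filter.atTop
        (nhds ((1 - q) * 0 - q * 0)) :=
      (((Filter.tendsto_add_atTop_iff_nat 1).2 hlim).const_mul _).sub (hlim.const_mul _)
    simp only [hconst] at h1
    have := tendsto_nhds_unique tendsto_const_nhds h1
    simpa using this
  have hval : v j = 1 / (1 - q) * (q / (1 - q)) ^ j := by
    induction j with
    | zero =>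
      rw [pow_zero, mul_one, eq_div_iff hp.ne']
      linarith
    | succ j ih =>
      have h1 := hconst j
      rw [hc, ih] at h1
      rw [pow_succ]
      field_simp at h1 ⊢
      linarith
  rw [← hval]
  exact (hs j).hasSum

end WalkProb

lemma walk_congr {ω ω' : ℕ → Discovery} {m t : ℕ} (h : ∀ i < m + t, ω i = ω' i) :
    walk ω m t = walk ω' m t := by
  induction t with
  | zero => rfl
  | succ t ih =>
    rw [walk, walk, ih fun i hi => h i (by omega), h (m + t) (by omega)]

lemma determinedBefore_walk (m t k : ℕ) : DeterminedBefore (m + t) {ω | walk ω m t = k} := by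
  intro ω ω' h
  simp only [Set.mem_ofPred_eq, walk_congr h]

lemma walk_succ_eq_two_iff {ω : ℕ → Discovery} {m t : ℕ} :
    walk ω m (t + 1) = 2 ↔ walk ω m t = 3 ∧ ω (m + t) ≠ .selfish := by
  constructor
  · intro h
    have h2 := two_le_walk_of_succ (t := t) (by omega : walk ω m (t + 1) ≠ 0)
    by_cases hω : ω (m + t) = .selfish
    · have := walk_selfish h2 hω
      omega
    · have := walk_honest h2 hω
      exact ⟨by omega, hω⟩
  · rintro ⟨h, hω⟩
    have := walk_honest (by omega) hω
    omega

lemma walk_succ_eq_add_three_iff {ω : ℕ → Discovery} {m t j : ℕ} :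
    walk ω m (t + 1) = j + 3 ↔ (walk ω m t = j + 2 ∧ ω (m + t) = .selfish) ∨
      (walk ω m t = j + 4 ∧ ω (m + t) ≠ .selfish) := by
  constructor
  · intro h
    have h2 := two_le_walk_of_succ (t := t) (by omega : walk ω m (t + 1) ≠ 0)
    by_cases hω : ω (m + t) = .selfish
    · have := walk_selfish h2 hω
      exact Or.inl ⟨by omega, hω⟩
    · have := walk_honest h2 hω
      exact Or.inr ⟨by omega, hω⟩
  · rintro (⟨h, hω⟩ | ⟨h, hω⟩)
    · have := walk_selfish (by omega) hω
      omega
    · have := walk_honest (by omega) hω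
      omega

lemma walk_le (ω : ℕ → Discovery) (m t : ℕ) : walk ω m t ≤ t + 2 := by
  induction t with
  | zero => rfl
  | succ t ih =>
    by_cases h : walk ω m (t + 1) = 0
    · omega
    · have h2 := two_le_walk_of_succ h
      by_cases hω : ω (m + t) = .selfish
      · have := walk_selfish h2 hω
        omega
      · have := walk_honest h2 hω
        omega

/-! ### Law of the walk and almost sure end of a lead -/

section Probability

variable {q γ : ℝ}

lemma discoveryLaw_selfish (hq₀ : 0 ≤ q) (hq₁ : q ≤ 1) (hγ₀ : 0 ≤ γ) (hγ₁ : γ ≤ 1) :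
    (discoveryLaw q γ).real {.selfish} = q := by
  simp [discoveryLaw_real hq₀ hq₁ hγ₀ hγ₁]

lemma discoveryLaw_honest (hq₀ : 0 ≤ q) (hq₁ : q ≤ 1) (hγ₀ : 0 ≤ γ) (hγ₁ : γ ≤ 1) :
    (discoveryLaw q γ).real {.selfish}ᶜ = 1 - q := by
  simp [discoveryLaw_real hq₀ hq₁ hγ₀ hγ₁]
  ring

instance [IsProbabilityMeasure (discoveryLaw q γ)] : IsProbabilityMeasure (miningLaw q γ) := by
  unfold miningLaw
  infer_instance

variable [IsProbabilityMeasure (discoveryLaw q γ)]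

/-- The walk started at `m` uses only discoveries from `m` on, hence is independent of `E`. Carrying
`E` along lets each induction step condition on the past and reproduce the recursion of `walkProb`.
-/
lemma DeterminedBefore.real_inter_walk (hq₀ : 0 ≤ q) (hq₁ : q ≤ 1) (hγ₀ : 0 ≤ γ) (hγ₁ : γ ≤ 1)
    {m : ℕ} {E : Set (ℕ → Discovery)} (h : DeterminedBefore m E) (t j : ℕ) :
    (miningLaw q γ).real (E ∩ {ω | walk ω m t = j + 2}) =
      (miningLaw q γ).real E * walkProb q t j := by
  have hdet : ∀ t k, DeterminedBefore (m + t) (E ∩ {ω | walk ω m t = k}) := fun t k =>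
    (h.mono (by omega)).inter (determinedBefore_walk m t k)
  induction t generalizing j with
  | zero =>
    cases j with
    | zero => simp [walk, walkProb]
    | succ j => simp [walk, walkProb]
  | succ t ih =>
    cases j with
    | zero =>
      have : E ∩ {ω | walk ω m (t + 1) = 0 + 2} =
          (E ∩ {ω | walk ω m t = 1 + 2}) ∩ {ω | ω (m + t) ∈ ({.selfish}ᶜ : Set Discovery)} := by
        ext ω
        simp [walk_succ_eq_two_iff, and_assoc]
      rw [this, (hdet t _).real_inter, ih, discoveryLaw_honest hq₀ hq₁ hγ₀ hγ₁, walkProb]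
      ring
    | succ j =>
      have : E ∩ {ω | walk ω m (t + 1) = j + 1 + 2} =
          ((E ∩ {ω | walk ω m t = j + 2}) ∩ {ω | ω (m + t) ∈ ({.selfish} : Set Discovery)}) ∪
          ((E ∩ {ω | walk ω m t = j + 2 + 2}) ∩
            {ω | ω (m + t) ∈ ({.selfish}ᶜ : Set Discovery)}) := by
        ext ω
        simp only [Set.mem_inter_iff, Set.mem_ofPred_eq, Set.mem_union, Set.mem_singleton_iff,
          Set.mem_compl_iff, walk_succ_eq_add_three_iff]
        tauto
      rw [this, measureReal_union, (hdet t _).real_inter, (hdet t _).real_inter, ih, ih,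
        discoveryLaw_honest hq₀ hq₁ hγ₀ hγ₁, discoveryLaw_selfish hq₀ hq₁ hγ₀ hγ₁, walkProb]
      · ring
      · rw [Set.disjoint_left]
        rintro ω ⟨-, h1⟩ ⟨-, h2⟩
        exact h2 h1
      · exact (((hdet t _).mono (by omega)).inter
          (DeterminedBefore.coord (m + t).lt_succ_self _)).measurableSet

/-- Almost surely, every lead of the selfish miner ends. -/
lemma ae_walk_end (hq₀ : 0 ≤ q) (hq : q < 1 / 2) (hγ₀ : 0 ≤ γ) (hγ₁ : γ ≤ 1) :
    ∀ᵐ ω ∂(miningLaw q γ), ∀ m, ∃ t, walk ω m t < 2 := by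
  rw [ae_all_iff]
  intro m
  rw [ae_iff]
  -- A walk that never ends has, at time `t`, one of the `t + 1` leads `2, …, t + 2`, each of
  -- probability at most the `t`-th power of the rate.
  have hbound : ∀ t : ℕ, (miningLaw q γ).real {ω | ¬ ∃ t, walk ω m t < 2} ≤
      ((t : ℝ) + 1) * (2 * (1 - q) * q + 1 / 2) ^ t := by
    intro t
    have hsub : {ω | ¬ ∃ t, walk ω m t < 2} ⊆
        ⋃ j ∈ Finset.range (t + 1), Set.univ ∩ {ω | walk ω m t = j + 2} := by
      intro ω hω
      simp only [Set.mem_ofPred_eq, not_exists, not_lt] at hω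
      simp only [Set.mem_iUnion, Finset.mem_range, Set.univ_inter, Set.mem_ofPred_eq]
      have h1 := hω t
      have h2 := walk_le ω m t
      exact ⟨walk ω m t - 2, by omega, by omega⟩
    calc (miningLaw q γ).real {ω | ¬ ∃ t, walk ω m t < 2}
        ≤ (miningLaw q γ).real
          (⋃ j ∈ Finset.range (t + 1), Set.univ ∩ {ω | walk ω m t = j + 2}) :=
          measureReal_mono hsub (measure_ne_top _ _)
      _ ≤ ∑ j ∈ Finset.range (t + 1),
          (miningLaw q γ).real (Set.univ ∩ {ω | walk ω m t = j + 2}) :=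
          measureReal_biUnion_finset_le _ _
      _ ≤ ∑ _j ∈ Finset.range (t + 1), (2 * (1 - q) * q + 1 / 2) ^ t := by
          refine Finset.sum_le_sum fun j _ => ?_
          rw [DeterminedBefore.real_inter_walk hq₀ (by linarith) hγ₀ hγ₁ (m := m)
            (fun _ _ _ => Iff.rfl), probReal_univ, one_mul]
          refine (walkProb_le hq₀ hq t j).trans
            (mul_le_of_le_one_right (pow_nonneg (rate_nonneg hq₀ hq) t) ?_)
          have : 0 < 2 * (1 - q) := by linarith
          refine pow_le_one₀ (by positivity) ?_
          rw [div_le_one this]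
          linarith
      _ = _ := by simp
  have hlim : Filter.Tendsto (fun t : ℕ => ((t : ℝ) + 1) * (2 * (1 - q) * q + 1 / 2) ^ t)
      Filter.atTop (nhds 0) := by
    have h1 := tendsto_self_mul_const_pow_of_lt_one (rate_nonneg hq₀ hq) (rate_lt_one hq)
    have h2 := tendsto_pow_atTop_nhds_zero_of_lt_one (rate_nonneg hq₀ hq) (rate_lt_one hq)
    simpa [add_mul] using h1.add h2
  have h0 := ge_of_tendsto' hlim hbound
  exact (measureReal_eq_zero_iff).1 (le_antisymm h0 measureReal_nonneg)

end Probability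

/-! ### Expectation of a count as a sum of probabilities -/

/-- The expected number of events of a summable sequence which occur. -/
lemma integral_ncard {Ω : Type*} [MeasurableSpace Ω] {μ : Measure Ω} [IsFiniteMeasure μ]
    {A : ℕ → Set Ω} (hA : ∀ u, MeasurableSet (A u)) {a : ℝ}
    (h : HasSum (fun u => μ.real (A u)) a) :
    Integrable (fun ω => (Set.ncard {u | ω ∈ A u} : ℝ)) μ ∧
      ∫ ω, (Set.ncard {u | ω ∈ A u} : ℝ) ∂μ = a := by
  have hcount : ∀ ω, (Set.ncard {u | ω ∈ A u} : ℝ) =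
      (∑' u, (A u).indicator (1 : Ω → ENNReal) ω).toReal := by
    intro ω
    have : ∑' u, (A u).indicator (1 : Ω → ENNReal) ω = ({u | ω ∈ A u} : Set ℕ).encard := by
      rw [← ENNReal.tsum_set_one, tsum_subtype {u | ω ∈ A u} (fun _ => (1 : ENNReal))]
      rfl
    rw [this, Set.ncard_def]
    -- For an infinite set both sides take the default value `0`, so the identity holds at every
    -- `ω`.
    rcases eq_or_ne ({u | ω ∈ A u} : Set ℕ).encard ⊤ with h | h
    · simp [h]
    · lift ({u | ω ∈ A u} : Set ℕ).encard to ℕ using h with n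
      simp
  have hmeas : ∀ u, Measurable ((A u).indicator (1 : Ω → ENNReal)) := fun u =>
    measurable_one.indicator (hA u)
  have hint : ∫⁻ ω, ∑' u, (A u).indicator (1 : Ω → ENNReal) ω ∂μ = ENNReal.ofReal a := by
    rw [lintegral_tsum fun u => (hmeas u).aemeasurable]
    simp only [lintegral_indicator_one (hA _)]
    rw [← h.tsum_eq, ENNReal.ofReal_tsum_of_nonneg (fun _ => measureReal_nonneg) h.summable]
    simp [measureReal_def]
  have hm : Measurable fun ω => ∑' u, (A u).indicator (1 : Ω → ENNReal) ω :=
    Measurable.tsum hmeas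
  simp only [hcount]
  constructor
  · exact integrable_toReal_of_lintegral_ne_top hm.aemeasurable (by simp [hint])
  · rw [integral_toReal hm.aemeasurable (ae_lt_top hm (by simp [hint])), hint,
      ENNReal.toReal_ofReal]
    rw [← h.tsum_eq]
    exact tsum_nonneg fun _ => measureReal_nonneg

/-! ### Probabilities of the uncle events and their sums -/

section Events

variable {q γ : ℝ}

lemma determinedBefore_pair (B₀ B₁ : Set Discovery) :
    DeterminedBefore 2 {ω | ω 0 ∈ B₀ ∧ ω 1 ∈ B₁} :=
  (DeterminedBefore.coord (by omega) B₀).inter (DeterminedBefore.coord (by omega) B₁)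

lemma determinedBefore_triple (B₀ B₁ B₂ : Set Discovery) :
    DeterminedBefore 3 {ω | ω 0 ∈ B₀ ∧ ω 1 ∈ B₁ ∧ ω 2 ∈ B₂} :=
  (DeterminedBefore.coord (by omega) B₀).inter
    ((DeterminedBefore.coord (by omega) B₁).inter (DeterminedBefore.coord (by omega) B₂))

lemma real_pair [IsProbabilityMeasure (discoveryLaw q γ)] (B₀ B₁ : Set Discovery) :
    (miningLaw q γ).real {ω | ω 0 ∈ B₀ ∧ ω 1 ∈ B₁} =
      (discoveryLaw q γ).real B₀ * (discoveryLaw q γ).real B₁ := by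
  have h0 := DeterminedBefore.real_inter (q := q) (γ := γ) (m := 0) (E := Set.univ)
    (fun _ _ _ => Iff.rfl) B₀
  have h1 := (DeterminedBefore.coord Nat.zero_lt_one B₀).real_inter (q := q) (γ := γ) B₁
  rw [Set.univ_inter, probReal_univ, one_mul] at h0
  rw [← h0, ← h1]
  rfl

lemma real_triple [IsProbabilityMeasure (discoveryLaw q γ)] (B₀ B₁ B₂ : Set Discovery) :
    (miningLaw q γ).real {ω | ω 0 ∈ B₀ ∧ ω 1 ∈ B₁ ∧ ω 2 ∈ B₂} =
      (discoveryLaw q γ).real B₀ * (discoveryLaw q γ).real B₁ *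
        (discoveryLaw q γ).real B₂ := by
  rw [← real_pair, ← (determinedBefore_pair B₀ B₁).real_inter]
  congr 1
  ext ω
  simp [and_assoc]

lemma DeterminedBefore.run {m : ℕ} {E : Set (ℕ → Discovery)} (h : DeterminedBefore m E)
    (i : ℕ) : DeterminedBefore (m + i) {ω | ω ∈ E ∧ ∀ j < i, ω (m + j) ≠ .selfish} := by
  refine (h.mono (by omega)).inter fun ω ω' hω => ?_
  refine forall₂_congr fun j hj => ?_
  rw [hω (m + j) (by omega)]

lemma determinedBefore_honestFirst (m : ℕ) : DeterminedBefore (m + 3) {ω | HonestFirst ω m} := by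
  intro ω ω' hω
  simp only [Set.mem_ofPred_eq, HonestFirst, hω m (by omega), hω (m + 1) (by omega),
    hω (m + 2) (by omega)]

lemma DeterminedBefore.forkUncle (t i : ℕ) : DeterminedBefore (2 + t + 1) (forkUncle t i) :=
  ((determinedBefore_pair {.selfish} {.selfish}).mono (by omega)).inter
    (((determinedBefore_walk 2 t (i + 2)).mono (by omega)).inter
      (DeterminedBefore.coord (2 + t).lt_succ_self
        {d | d = .honestOnSelfish ∨ d = .honestOnHonest ∧ i = t}))

lemma DeterminedBefore.forkUncleHonest (t i : ℕ) :
    DeterminedBefore (2 + t + 1 + i + 3) (forkUncleHonest t i) :=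
  (((DeterminedBefore.forkUncle t i).run i).mono (by omega)).inter
    (determinedBefore_honestFirst _)

lemma measurableSet_uncleEvent (n₁ u : ℕ) : MeasurableSet (uncleEvent n₁ u) := by
  rcases u with _ | _ | t
  · exact (determinedBefore_triple {.selfish} {.selfish}ᶜ {.honestOnHonest}).measurableSet
  · exact (determinedBefore_triple {.selfish} {.selfish}ᶜ {.honestOnHonest}ᶜ).measurableSet
  · exact Finset.measurableSet_biUnion _ fun i _ => (DeterminedBefore.forkUncle t i).measurableSet

lemma measurableSet_uncleHonestEvent (n₁ u : ℕ) : MeasurableSet (uncleHonestEvent n₁ u) := by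
  rcases u with _ | _ | t
  · exact (determinedBefore_triple {.selfish} {.selfish}ᶜ {.honestOnHonest}).measurableSet
  · exact (determinedBefore_triple {.selfish} {.selfish}ᶜ {.honestOnSelfish}).measurableSet
  · exact Finset.measurableSet_biUnion _ fun i _ =>
      (DeterminedBefore.forkUncleHonest t i).measurableSet

variable [IsProbabilityMeasure (discoveryLaw q γ)]

lemma real_uncleEvent_add_two (n₁ t : ℕ) : (miningLaw q γ).real (uncleEvent n₁ (t + 2)) =
    ∑ i ∈ Finset.range (n₁ - 1), (miningLaw q γ).real (forkUncle t i) := by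
  refine measureReal_biUnion_finset ?_ fun i _ => (DeterminedBefore.forkUncle t i).measurableSet
  intro i _ j _ hij
  exact Set.disjoint_left.2 fun ω h h' => hij (forkUncle_lead_unique h h')

lemma real_uncleHonestEvent_add_two (n₁ t : ℕ) :
    (miningLaw q γ).real (uncleHonestEvent n₁ (t + 2)) =
      ∑ i ∈ Finset.range (n₁ - 1), (miningLaw q γ).real (forkUncleHonest t i) := by
  refine measureReal_biUnion_finset ?_
    fun i _ => (DeterminedBefore.forkUncleHonest t i).measurableSet
  intro i _ j _ hij
  exact Set.disjoint_left.2 fun ω h h' => hij (forkUncle_lead_unique h.1.1 h'.1.1)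

lemma DeterminedBefore.real_run (hq₀ : 0 ≤ q) (hq₁ : q ≤ 1) (hγ₀ : 0 ≤ γ) (hγ₁ : γ ≤ 1)
    {m : ℕ} {E : Set (ℕ → Discovery)} (h : DeterminedBefore m E) (i : ℕ) :
    (miningLaw q γ).real {ω | ω ∈ E ∧ ∀ j < i, ω (m + j) ≠ .selfish} =
      (miningLaw q γ).real E * (1 - q) ^ i := by
  induction i with
  | zero => simp
  | succ i ih =>
    have : {ω | ω ∈ E ∧ ∀ j < i + 1, ω (m + j) ≠ .selfish} =
        {ω | ω ∈ E ∧ ∀ j < i, ω (m + j) ≠ .selfish} ∩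
          {ω | ω (m + i) ∈ ({.selfish}ᶜ : Set Discovery)} := by
      ext ω
      simp only [Set.mem_ofPred_eq, Set.mem_inter_iff, Nat.forall_lt_succ_right,
        Set.mem_compl_iff, Set.mem_singleton_iff, and_assoc, ne_eq]
    rw [this, (h.run i).real_inter, ih, discoveryLaw_honest hq₀ hq₁ hγ₀ hγ₁]
    ring

/-- Either the next block is honest, or a selfish and an honest block compete and an honest miner
settles this on the honest branch: `p + q · p · p(1 - γ)`. -/
lemma DeterminedBefore.real_honestFirst (hq₀ : 0 ≤ q) (hq₁ : q ≤ 1) (hγ₀ : 0 ≤ γ) (hγ₁ : γ ≤ 1)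
    {m : ℕ} {E : Set (ℕ → Discovery)}
    (h : DeterminedBefore m E) : (miningLaw q γ).real {ω | ω ∈ E ∧ HonestFirst ω m} =
      (miningLaw q γ).real E * ((1 - q) + (1 - γ) * (1 - q) ^ 2 * q) := by
  have h1 : DeterminedBefore (m + 1) (E ∩ {ω | ω m ∈ ({.selfish} : Set Discovery)}) :=
    (h.mono (by omega)).inter (DeterminedBefore.coord (by omega) _)
  have h2 : DeterminedBefore (m + 2) ((E ∩ {ω | ω m ∈ ({.selfish} : Set Discovery)}) ∩
      {ω | ω (m + 1) ∈ ({.selfish}ᶜ : Set Discovery)}) :=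
    (h1.mono (by omega)).inter (DeterminedBefore.coord (by omega) _)
  have : {ω | ω ∈ E ∧ HonestFirst ω m} =
      (E ∩ {ω | ω m ∈ ({.selfish}ᶜ : Set Discovery)}) ∪
      (((E ∩ {ω | ω m ∈ ({.selfish} : Set Discovery)}) ∩
        {ω | ω (m + 1) ∈ ({.selfish}ᶜ : Set Discovery)}) ∩
          {ω | ω (m + 2) ∈ ({.honestOnHonest} : Set Discovery)}) := by
    ext ω
    simp only [Set.mem_ofPred_eq, HonestFirst, Set.mem_union, Set.mem_inter_iff,
      Set.mem_compl_iff, Set.mem_singleton_iff]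
    tauto
  rw [this, measureReal_union, h.real_inter, h2.real_inter, h1.real_inter, h.real_inter,
    discoveryLaw_honest hq₀ hq₁ hγ₀ hγ₁, discoveryLaw_selfish hq₀ hq₁ hγ₀ hγ₁,
    discoveryLaw_real hq₀ hq₁ hγ₀ hγ₁]
  · simp
    ring
  · rw [Set.disjoint_left]
    rintro ω ⟨-, h1⟩ ⟨⟨⟨-, h2⟩, -⟩, -⟩
    exact h1 h2
  · exact ((h2.mono (by omega)).inter
      (DeterminedBefore.coord (m + 2).lt_succ_self _)).measurableSet

lemma real_forkUncle (hq₀ : 0 ≤ q) (hq₁ : q ≤ 1) (hγ₀ : 0 ≤ γ) (hγ₁ : γ ≤ 1)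
    (t i : ℕ) : (miningLaw q γ).real (forkUncle t i) =
    q ^ 2 * ((1 - q) * γ * walkProb q t i +
      if t = i then (1 - q) * (1 - γ) * q ^ i else 0) := by
  have hE := determinedBefore_pair {.selfish} {.selfish}
  have hdet := (hE.mono (by omega : 2 ≤ 2 + t)).inter (determinedBefore_walk 2 t (i + 2))
  have := hdet.real_inter (q := q) (γ := γ)
    {d | d = .honestOnSelfish ∨ d = .honestOnHonest ∧ i = t}
  rw [hE.real_inter_walk hq₀ hq₁ hγ₀ hγ₁, real_pair, discoveryLaw_selfish hq₀ hq₁ hγ₀ hγ₁,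
    discoveryLaw_real hq₀ hq₁ hγ₀ hγ₁] at this
  have hset : forkUncle t i = {ω | ω 0 ∈ ({.selfish} : Set Discovery) ∧
      ω 1 ∈ ({.selfish} : Set Discovery)} ∩ {ω | walk ω 2 t = i + 2} ∩
      {ω | ω (2 + t) ∈ {d | d = .honestOnSelfish ∨ d = .honestOnHonest ∧ i = t}} := by
    ext ω
    simp only [forkUncle, Set.mem_inter_iff, Set.mem_ofPred_eq, Set.mem_singleton_iff, and_assoc]
  rw [hset, this]
  by_cases h : t = i
  · subst h
    simp [walkProb_self]
    ring
  · simp [h, Ne.symm h]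
    ring

/-- The uncle, the run of `i` honest blocks and the start of the next cycle occupy consecutive
disjoint time windows, so their probabilities multiply. -/
lemma real_forkUncleHonest (hq₀ : 0 ≤ q) (hq₁ : q ≤ 1) (hγ₀ : 0 ≤ γ) (hγ₁ : γ ≤ 1)
    (t i : ℕ) : (miningLaw q γ).real (forkUncleHonest t i) =
    (miningLaw q γ).real (forkUncle t i) *
      ((1 - q) ^ i * ((1 - q) + (1 - γ) * (1 - q) ^ 2 * q)) := by
  have hdet := DeterminedBefore.forkUncle t i
  have := (hdet.run i).real_honestFirst (q := q) (γ := γ) hq₀ hq₁ hγ₀ hγ₁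
  rw [hdet.real_run hq₀ hq₁ hγ₀ hγ₁, mul_assoc] at this
  exact this

/-- At a fixed lead, the sum over time of the first term is the expected number of visits; the uncle
mined on the empty honest branch is counted only at `t = i`. -/
lemma hasSum_real_forkUncle (hq₀ : 0 ≤ q) (hγ₀ : 0 ≤ γ) (hγ₁ : γ ≤ 1)
    (hq : q < 1 / 2) (i : ℕ) :
    HasSum (fun t => (miningLaw q γ).real (forkUncle t i))
      (q ^ 2 * (γ * (q / (1 - q)) ^ i + (1 - q) * (1 - γ) * q ^ i)) := by
  have hp : 1 - q ≠ 0 := by linarith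
  simp only [real_forkUncle hq₀ (by linarith : q ≤ 1) hγ₀ hγ₁]
  have h1 := (hasSum_walkProb hq₀ hq i).mul_left ((1 - q) * γ)
  have h2 := hasSum_ite_eq i ((1 - q) * (1 - γ) * q ^ i)
  have : (1 - q) * γ * (1 / (1 - q) * (q / (1 - q)) ^ i) = γ * (q / (1 - q)) ^ i := by
    field_simp
  rw [this] at h1
  exact (h1.add h2).mul_left (q ^ 2)

lemma hasSum_real_uncleEvent (hq₀ : 0 ≤ q) (hγ₀ : 0 ≤ γ) (hγ₁ : γ ≤ 1)
    (hq : q < 1 / 2) (n₁ : ℕ) :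
    HasSum (fun u => (miningLaw q γ).real (uncleEvent n₁ u))
      (∑ i ∈ Finset.range (n₁ - 1),
          q ^ 2 * (γ * (q / (1 - q)) ^ i + (1 - q) * (1 - γ) * q ^ i) + (1 - q) * q) := by
  have hq₁ : q ≤ 1 := by linarith
  have h0 : (miningLaw q γ).real (uncleEvent n₁ 0) = q * (1 - q) * ((1 - q) * (1 - γ)) := by
    refine (real_triple (q := q) (γ := γ) {.selfish} {.selfish}ᶜ {.honestOnHonest}).trans ?_
    rw [discoveryLaw_selfish hq₀ hq₁ hγ₀ hγ₁, discoveryLaw_honest hq₀ hq₁ hγ₀ hγ₁,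
      discoveryLaw_real hq₀ hq₁ hγ₀ hγ₁]
    simp
  have h1 : (miningLaw q γ).real (uncleEvent n₁ 1) = q * (1 - q) * (q + (1 - q) * γ) := by
    refine (real_triple (q := q) (γ := γ) {.selfish} {.selfish}ᶜ {.honestOnHonest}ᶜ).trans ?_
    rw [discoveryLaw_selfish hq₀ hq₁ hγ₀ hγ₁, discoveryLaw_honest hq₀ hq₁ hγ₀ hγ₁,
      discoveryLaw_real hq₀ hq₁ hγ₀ hγ₁]
    simp
  have h2 := hasSum_sum (s := Finset.range (n₁ - 1))
    fun i _ => hasSum_real_forkUncle (q := q) (γ := γ) hq₀ hγ₀ hγ₁ hq i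
  simp only [← real_uncleEvent_add_two] at h2
  have h3 := (hasSum_nat_add_iff (f := fun u => (miningLaw q γ).real (uncleEvent n₁ u)) 2).1 h2
  -- The two competition events are exclusive and together say only that the cycle starts with a
  -- selfish and then an honest block.
  have h4 : ∑ i ∈ Finset.range 2, (miningLaw q γ).real (uncleEvent n₁ i) = (1 - q) * q := by
    rw [Finset.sum_range_succ, Finset.sum_range_one, h0, h1]
    ring
  rwa [h4] at h3

lemma hasSum_real_uncleHonestEvent (hq₀ : 0 ≤ q) (hγ₀ : 0 ≤ γ) (hγ₁ : γ ≤ 1)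
    (hq : q < 1 / 2) (n₁ : ℕ) :
    HasSum (fun u => (miningLaw q γ).real (uncleHonestEvent n₁ u))
      (∑ i ∈ Finset.range (n₁ - 1),
          q ^ 2 * (γ * (q / (1 - q)) ^ i + (1 - q) * (1 - γ) * q ^ i) *
            ((1 - q) ^ i * ((1 - q) + (1 - γ) * (1 - q) ^ 2 * q)) + (1 - q) ^ 2 * q) := by
  have hq₁ : q ≤ 1 := by linarith
  have h0 : (miningLaw q γ).real (uncleHonestEvent n₁ 0) =
      q * (1 - q) * ((1 - q) * (1 - γ)) := by
    refine (real_triple (q := q) (γ := γ) {.selfish} {.selfish}ᶜ {.honestOnHonest}).trans ?_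
    rw [discoveryLaw_selfish hq₀ hq₁ hγ₀ hγ₁, discoveryLaw_honest hq₀ hq₁ hγ₀ hγ₁,
      discoveryLaw_real hq₀ hq₁ hγ₀ hγ₁]
    simp
  have h1 : (miningLaw q γ).real (uncleHonestEvent n₁ 1) = q * (1 - q) * ((1 - q) * γ) := by
    refine (real_triple (q := q) (γ := γ) {.selfish} {.selfish}ᶜ {.honestOnSelfish}).trans ?_
    rw [discoveryLaw_selfish hq₀ hq₁ hγ₀ hγ₁, discoveryLaw_honest hq₀ hq₁ hγ₀ hγ₁,
      discoveryLaw_real hq₀ hq₁ hγ₀ hγ₁]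
    simp
  have h2 := hasSum_sum (s := Finset.range (n₁ - 1)) fun i _ =>
    (hasSum_real_forkUncle (q := q) (γ := γ) hq₀ hγ₀ hγ₁ hq i).mul_right
      ((1 - q) ^ i * ((1 - q) + (1 - γ) * (1 - q) ^ 2 * q))
  simp only [← real_forkUncleHonest hq₀ hq₁ hγ₀ hγ₁,
    ← real_uncleHonestEvent_add_two] at h2
  have h3 := (hasSum_nat_add_iff (f := fun u => (miningLaw q γ).real (uncleHonestEvent n₁ u)) 2).1 h2
  have h4 : ∑ i ∈ Finset.range 2, (miningLaw q γ).real (uncleHonestEvent n₁ i) = (1 - q) ^ 2 * q := by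
    rw [Finset.sum_range_succ, Finset.sum_range_one, h0, h1]
    ring
  rwa [h4] at h3

end Events

/-! ### Splitting by nephew and final computation -/

/-- The referred uncles of a finite cycle have either a selfish or an honest nephew. -/
lemma unclesSelfish_eq {n₁ : ℕ} {ω : ℕ → Discovery} (hfin : (cycleBlocks ω).Finite) :
    (unclesSelfish n₁ ω : ℝ) = uncles n₁ ω - unclesHonest n₁ ω := by
  rw [eq_sub_iff_add_eq, ← Nat.cast_add, unclesSelfish, unclesHonest, uncles,
    ← Set.ncard_union_eq ?_ (hfin.subset fun u h => h.1) (hfin.subset fun u h => h.1)]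
  · congr 2
    ext u
    simp only [Set.mem_union, Set.mem_ofPred_eq]
    constructor
    · rintro (⟨h1, h2, n, h3, -, h4⟩ | ⟨h1, h2, n, h3, -, h4⟩) <;> exact ⟨h1, h2, n, h3, h4⟩
    · rintro ⟨h1, h2, n, h3, h4⟩
      by_cases hn : ω n = .selfish
      · exact Or.inl ⟨h1, h2, n, h3, hn, h4⟩
      · exact Or.inr ⟨h1, h2, n, h3, hn, h4⟩
  · rw [Set.disjoint_left]
    rintro u ⟨-, -, n, h3, h4, h5⟩ ⟨-, -, m, h6, h7, h8⟩
    rw [nephew_unique h6 h3 h8 h5] at h7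
    exact h7 h4

/-- Finiteness is needed because `Set.ncard` is additive on disjoint finite sets, while infinite
sets get the value `0`. -/
lemma cycleBlocks_finite {ω : ℕ → Discovery} (hω : ∀ m, ∃ t, walk ω m t < 2) :
    (cycleBlocks ω).Finite := by
  suffices ∃ T, ∀ u ∈ cycleBlocks ω, u < T by
    obtain ⟨T, hT⟩ := this
    exact (Set.finite_Iio T).subset hT
  by_cases h₀ : ω 0 = .selfish
  · by_cases h₁ : ω 1 = .selfish
    · obtain ⟨e, D, -, h, -⟩ := fork_cycle hω h₀ h₁
      exact ⟨_, fun u hu => (h u).1 hu⟩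
    · obtain ⟨D, -, h, -⟩ := competition_cycle h₀ h₁
      exact ⟨_, fun u hu => (h u).1 hu⟩
  · refine ⟨1, fun u hu => ?_⟩
    by_contra h
    refine hu 1 le_rfl (by omega) ?_
    have e1 := state_one_honest (ω := ω) (T := 0) (D := []) rfl h₀
    simp only [Nat.zero_add] at e1
    rw [e1]
    rfl

end SelfishMining

theorem mainTheorem5 (p q γ : ℝ) (n₁ : ℕ) (hpq : p + q = 1) (hq : 0 ≤ q) (hqp : q < p)
    (hγ₀ : 0 ≤ γ) (hγ₁ : γ ≤ 1) (hn₁ : 1 ≤ n₁) :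
    Integrable (fun ω => (SelfishMining.uncles n₁ ω : ℝ)) (SelfishMining.miningLaw q γ) ∧
    Integrable (fun ω => (SelfishMining.unclesHonest n₁ ω : ℝ)) (SelfishMining.miningLaw q γ) ∧
    Integrable (fun ω => (SelfishMining.unclesSelfish n₁ ω : ℝ)) (SelfishMining.miningLaw q γ) ∧
    ∫ ω, (SelfishMining.unclesSelfish n₁ ω : ℝ) ∂(SelfishMining.miningLaw q γ) =
      ∫ ω, (SelfishMining.uncles n₁ ω : ℝ) ∂(SelfishMining.miningLaw q γ) -
        ∫ ω, (SelfishMining.unclesHonest n₁ ω : ℝ) ∂(SelfishMining.miningLaw q γ) ∧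
    ∫ ω, (SelfishMining.unclesSelfish n₁ ω : ℝ) ∂(SelfishMining.miningLaw q γ) =
      q + q ^ 3 * γ / (p - q) - p * q ^ 2 / (p - q) * (q / p) ^ (n₁ - 1) * γ
        - q ^ (n₁ + 1) * (1 - γ)
        - (p ^ 2 * q + (p + (1 - γ) * p ^ 2 * q) *
            (q ^ 2 / p * (1 - q ^ (n₁ - 1)) * γ
              + (1 - γ) * p * q ^ 2 * ((1 - (p * q) ^ (n₁ - 1)) / (1 - p * q)))) := by
  open SelfishMining in
  obtain rfl : p = 1 - q := by linarith
  have hq2 : q < 1 / 2 := by linarith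
  have hprob := discoveryLaw_isProbabilityMeasure hq (by linarith) hγ₀ hγ₁
  have hae := ae_walk_end (q := q) (γ := γ) hq hq2 hγ₀ hγ₁
  obtain ⟨hI, hE⟩ := integral_ncard (measurableSet_uncleEvent n₁)
    (hasSum_real_uncleEvent hq hγ₀ hγ₁ hq2 n₁)
  obtain ⟨hI', hE'⟩ := integral_ncard (measurableSet_uncleHonestEvent n₁)
    (hasSum_real_uncleHonestEvent hq hγ₀ hγ₁ hq2 n₁)
  have hU : (fun ω => (Set.ncard {u | ω ∈ uncleEvent n₁ u} : ℝ)) =ᵐ[miningLaw q γ]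
      fun ω => (uncles n₁ ω : ℝ) := by
    filter_upwards [hae] with ω hω
    rw [uncles]
    congr 2
    ext u
    exact (referred_uncle_iff hω hn₁ u).symm
  have hUh : (fun ω => (Set.ncard {u | ω ∈ uncleHonestEvent n₁ u} : ℝ)) =ᵐ[miningLaw q γ]
      fun ω => (unclesHonest n₁ ω : ℝ) := by
    filter_upwards [hae] with ω hω
    rw [unclesHonest]
    congr 2
    ext u
    exact (referred_uncle_honest_iff hω hn₁ u).symm
  have hUs : (fun ω => (uncles n₁ ω : ℝ) - (unclesHonest n₁ ω : ℝ)) =ᵐ[miningLaw q γ]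
      fun ω => (unclesSelfish n₁ ω : ℝ) := by
    filter_upwards [hae] with ω hω
    exact (unclesSelfish_eq (cycleBlocks_finite hω)).symm
  replace hI := hI.congr hU
  replace hI' := hI'.congr hUh
  rw [integral_congr_ae hU] at hE
  rw [integral_congr_ae hUh] at hE'
  have hsub := integral_congr_ae hUs
  rw [integral_sub hI hI'] at hsub
  refine ⟨hI, hI', (hI.sub hI').congr hUs, hsub.symm, ?_⟩
  rw [← hsub, hE, hE']
  have hp : 1 - q ≠ 0 := by linarith
  have hp1 : q / (1 - q) ≠ 1 := by
    rw [Ne, div_eq_one_iff_eq hp]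
    linarith
  have hp2 : 1 - q - q ≠ 0 := by linarith
  have hp3 : (1 - q) * q ≠ 1 := by nlinarith
  have hsum : ∑ i ∈ Finset.range (n₁ - 1),
      q ^ 2 * (γ * (q / (1 - q)) ^ i + (1 - q) * (1 - γ) * q ^ i) =
      q ^ 2 * (γ * (((q / (1 - q)) ^ (n₁ - 1) - 1) / (q / (1 - q) - 1)) +
        (1 - q) * (1 - γ) * ((q ^ (n₁ - 1) - 1) / (q - 1))) := by
    rw [← geom_sum_eq hp1, ← geom_sum_eq (by linarith : q ≠ 1), ← Finset.mul_sum,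
      Finset.sum_add_distrib, Finset.mul_sum, Finset.mul_sum]
  -- The run of `i` honest blocks contributes `(1 - q) ^ i`, which turns the ratios `q / (1 - q)`
  -- and `q` into `q` and `(1 - q) * q`.
  have hsum' : ∑ i ∈ Finset.range (n₁ - 1),
      q ^ 2 * (γ * (q / (1 - q)) ^ i + (1 - q) * (1 - γ) * q ^ i) *
        ((1 - q) ^ i * ((1 - q) + (1 - γ) * (1 - q) ^ 2 * q)) =
      q ^ 2 * (γ * ((q ^ (n₁ - 1) - 1) / (q - 1)) + (1 - q) * (1 - γ) *
        ((((1 - q) * q) ^ (n₁ - 1) - 1) / ((1 - q) * q - 1))) *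
        ((1 - q) + (1 - γ) * (1 - q) ^ 2 * q) := by
    rw [← geom_sum_eq hp3, ← geom_sum_eq (by linarith : q ≠ 1), Finset.mul_sum,
      Finset.mul_sum, ← Finset.sum_add_distrib, Finset.mul_sum, Finset.sum_mul]
    refine Finset.sum_congr rfl fun i _ => ?_
    have : (q / (1 - q)) ^ i * (1 - q) ^ i = q ^ i := by
      rw [← mul_pow, div_mul_cancel₀ _ hp]
    rw [mul_pow]
    linear_combination (q ^ 2 * γ * ((1 - q) + (1 - γ) * (1 - q) ^ 2 * q)) * this
  rw [hsum, hsum']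
  have hx : ((q / (1 - q)) ^ (n₁ - 1) - 1) / (q / (1 - q) - 1) =
      (1 - (q / (1 - q)) ^ (n₁ - 1)) * (1 - q) / (1 - q - q) := by
    have : q / (1 - q) - 1 = -((1 - q - q) / (1 - q)) := by
      field_simp
      ring
    rw [this, div_neg, ← neg_div, neg_sub, div_div_eq_mul_div]
  have hy : (q ^ (n₁ - 1) - 1) / (q - 1) = (1 - q ^ (n₁ - 1)) / (1 - q) := by
    rw [← neg_sub 1 q, ← neg_sub 1 (q ^ (n₁ - 1)), neg_div_neg_eq]
  have hz : (((1 - q) * q) ^ (n₁ - 1) - 1) / ((1 - q) * q - 1) =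
      (1 - ((1 - q) * q) ^ (n₁ - 1)) / (1 - (1 - q) * q) := by
    rw [← neg_sub 1 ((1 - q) * q), ← neg_sub 1 (((1 - q) * q) ^ (n₁ - 1)), neg_div_neg_eq]
  -- Here `1 ≤ n₁` matters: the natural subtraction `n₁ - 1` is not truncated.
  have hpow : q ^ (n₁ + 1) = q ^ 2 * q ^ (n₁ - 1) := by
    rw [← pow_add]
    congr 1
    omega
  rw [hx, hy, hz, hpow]
  -- No relation between the powers is needed any more: what remains is a rational identity in `q`,
  -- `γ`, `a`, `b`, `c`.
  generalize (q / (1 - q)) ^ (n₁ - 1) = a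
  generalize q ^ (n₁ - 1) = b
  generalize (1 - ((1 - q) * q) ^ (n₁ - 1)) / (1 - (1 - q) * q) = c
  field_simp
  ring
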